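/- **Setting.** Let $\alpha_v=\{a_+,a_-,b_+,b_-\}$. An $n$-component *nanophrase* over $\alpha_v$ is a finite alphabet $\mathcal A$ with a map $A\mapsto|A|\in\alpha_v$ and a phrase $p=w_1|w_2|\cdots|w_n$ of words on $\mathcal A$ in which every letter of $\mathcal A$ occurs exactly twice in total. Let $\tau_v,\nu_v,\sigma_v$ be the involutions of $\alpha_v$ with $\tau_v:a_\pm\leftrightarrow b_\mp$, $\nu_v:a_\pm\leftrightarrow b_\pm$, $\sigma_v:a_+\leftrightarrow a_-,\ b_+\leftrightarrow b_-$, and let $S'_w\subset(\alpha_v\cup\{\emptyset\})^3$ be the set of the 24 triples $$\begin{gathered}(a_\pm,a_\pm,a_\pm),\ (a_\pm,a_\pm,a_\mp),\ (a_\pm,a_\mp,a_\mp),\ (b_\pm,b_\pm,b_\pm),\ (b_\pm,b_\pm,b_\mp),\ (b_\pm,b_\mp,b_\mp),\\ (a_+,a_+,\emptyset),(a_+,b_-,\emptyset),(b_-,a_+,\emptyset),(b_-,b_-,\emptyset),\\ (a_-,\emptyset,b_-),(b_+,\emptyset,a_+),(a_-,\emptyset,a_+),(b_+,\emptyset,b_-),\\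 (\emptyset,a_-,a_-),(\emptyset,a_-,b_+),(\emptyset,b_+,a_-),(\emptyset,b_+,b_+).\end{gathered}$$ *Extended $M$-homotopy* is the equivalence relation on $n$-component nanophrases over $\alpha_v$ generated by isomorphisms (bijections of alphabets that preserve $|\cdot|$ and carry each component letterwise to the corresponding component) and the following moves, where $x,y,z,t$ are arbitrary sequences of letters and bars: * H1: $(\mathcal A,xAAy)\leftrightarrow(\mathcal A\setminus\{A\},xy)$; * H2: $(\mathcal A,xAByBAz)\leftrightarrow(\mathcal A\setminus\{A,B\},xyz)$ if $\tau_v(|A|)=|B|$; * (extended) H3: $(\mathcal A,xAByACzBCt)\leftrightarrow(\mathcal A,xBAyCAzCBt)$ if $(|A|,|B|,|C|)\in S'_w$, where each of $A,B,C$ is a letter or the empty word $\emptyset$, and $|\emptyset|=\emptyset$; * self crossing: if a letter $A$ occurs twice in the same component, replace $|A|$ by $\sigma_v(|A|)$; * shift: replace a component $Ax$ by $xA$ and, if $x$ contains $A$, replace $|A|$ by $\nu_v(|A|)$. **The invariant.** For an occurrence of a letter $A$ in $w_i$ whose other occurrence is in $w_k$, let its sign be $\varepsilon=1$ if ($i<k$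 and $|A|=b_+$) or ($i>k$ and $|A|=a_+$), $\varepsilon=-1$ if ($i<k$ and $|A|=a_-$) or ($i>k$ and $|A|=b_-$), and $\varepsilon=0$ otherwise. Let $w_i^\varepsilon$ be the word on $\mathcal A\cup\mathcal A^{-1}$ obtained from $w_i$ by giving each occurrence its sign as exponent, where $A^0$ is the empty word. Let $\eta(A^{\pm1})=a_k^{\pm1}$, where $w_k$ is the component containing the second occurrence of $A$ in $p$ if $|A|\in\{b_+,a_-\}$, and the first one if $|A|\in\{a_+,b_-\}$. If the two occurrences of $A$ are in different components, let $x_A$ be the part of $w_k^\varepsilon$, with this $k$, that precedes the occurrence of $A$ in $w_k$. On words in such signed letters let $\rho^2=\mathrm{id}$ and, for $q\ge3$, let $\rho^q$ be the concatenation-preserving map with $\rho^q(A^{\pm1})=\rho^{q-1}(x_A^{-1})\,A^{\pm1}\,\rho^{q-1}(x_A)$. Let $\varphi$ be the multiplicative map from words in $a_1^{\pm1},\dots,a_n^{\pm1}$ to the ring of formal power series over $\mathbb Z$ in noncommuting variables $\kappa_1,\dots,\kappa_n$ with $\varphi(a_h)=1+\kappa_h$ and $\varphi(a_h^{-1})=1-\kappa_h+\kappa_h^2-\cdots$.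 The coefficients of $\varphi\circ\eta(\rho^q(w_i^\varepsilon))$ are eventually constant as $q\to\infty$; for $u\ge1$ let $\mu(p;c_1,\dots,c_u,i)$ be the limit of the coefficient of $\kappa_{c_1}\cdots\kappa_{c_u}$. Let $\Delta(p;c_1,\dots,c_u,i)$ be the greatest common divisor of the numbers $\mu(p;d_1,\dots,d_t)$ over all sequences $d_1,\dots,d_t$ with $t\ge2$ obtained from $c_1,\dots,c_u,i$ by eliminating at least one index and permuting the remaining ones cyclically ($\Delta=0$ if $u=1$), and let $\bar\mu(p;c_1,\dots,c_u,i)$ be the residue class of $\mu(p;c_1,\dots,c_u,i)$ modulo $\Delta(p;c_1,\dots,c_u,i)$. **Theorem.** Let $u\ge1$ and let $c_1,\dots,c_u,i$ be pairwise distinct integers between $1$ and $n$. If $p$ and $p'$ are $n$-component nanophrases over $\alpha_v$ that are related by extended $M$-homotopy, then $$\bar\mu(p;c_1,\dots,c_u,i)=\bar\mu(p';c_1,\dots,c_u,i),$$ that is, $\Delta(p;c_1,\dots,c_u,i)=\Delta(p';c_1,\dots,c_u,i)$ and $\mu(p;c_1,\dots,c_u,i)\equiv\mu(p';c_1,\dots,c_u,i)$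 modulo this number. -/

import Mathlib

universe u

/-! ### Words, phrases and nanophrases -/

/-- The symbols used to write a phrase in one line: letters, and the bar `|` that separates
consecutive components. -/
inductive Token (L : Type u) : Type u
  | letter (A : L) : Token L
  | bar : Token L

namespace Token

/-- Apply a map of letters to a symbol. -/
def map {L L' : Type u} (f : L → L') : Token L → Token L'
  | letter A => letter (f A)
  | bar => bar

/-- An element of `L ∪ {∅}` (a letter, or the empty word `none`) as a sequence of symbols. -/
def ofOption {L : Type u} : Option L → List (Token L)
  | some A => [letter A]
  | none => []

end Token

/-- The phrase `w₁|w₂|⋯|wₙ` written in one line. -/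
def flatPhrase {L : Type u} {n : ℕ} (w : Fin n → List L) : List (Token L) :=
  [Token.bar].intercalate (List.ofFn fun k => (w k).map Token.letter)

/-- `w₁|⋯|wₙ` is a Gauss phrase on the alphabet `L`: every letter of `L` occurs exactly twice in
the concatenation `w₁⋯wₙ`. -/
def IsGauss {L : Type u} [DecidableEq L] {n : ℕ} (w : Fin n → List L) : Prop :=
  ∀ A : L, (List.ofFn w).flatten.count A = 2

/-- An `n`-component nanophrase over `α`: an alphabet with a projection to `α`, and an
`n`-component Gauss phrase on it. (The alphabet is finite because of the Gauss condition,
see `Nanophrase.finite_letter`.) -/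
structure Nanophrase (α : Type*) (n : ℕ) where
  /-- the alphabet -/
  Letter : Type u
  /-- equality of letters is decidable -/
  [dec : DecidableEq Letter]
  /-- the projection `A ↦ |A|` -/
  proj : Letter → α
  /-- the components -/
  word : Fin n → List Letter
  gauss : IsGauss word

attribute [instance] Nanophrase.dec

theorem Nanophrase.finite_letter {α : Type*} {n : ℕ} (p : Nanophrase.{u} α n) :
    Finite p.Letter := by
  have h : ∀ A : p.Letter, A ∈ (List.ofFn p.word).flatten.toFinset := by
    intro A
    have hA := p.gauss A
    rw [List.mem_toFinset]
    exact List.count_pos_iff.1 (by omega)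
  have hu : (Set.univ : Set p.Letter) ⊆ ((List.ofFn p.word).flatten.toFinset : Set p.Letter) :=
    fun A _ => h A
  exact Set.finite_univ_iff.1 ((Finset.finite_toSet _).subset hu)

/-! ### Extended `M`-homotopy -/

/-- The data on which an extended `M`-homotopy depends: involutions `τ`, `ν`, `σ` of `α` and a
subset `S'` of `(α ∪ {∅})³`; the element `∅` is `none`. -/
structure ExtHomotopyData (α : Type*) where
  /-- the involution of the second homotopy move -/
  τ : α → α
  /-- the involution of the shift move -/
  ν : α → α
  /-- the involution of the self crossing move -/
  σ : α → α
  τ_invol : Function.Involutive τ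
  ν_invol : Function.Involutive ν
  σ_invol : Function.Involutive σ
  /-- the triples that allow the (extended) third homotopy move -/
  S' : Set (Option α × Option α × Option α)

/-- The moves that generate extended `M`-homotopy. In `h1`, `h2`, `h3` the lists `x y z t` are
arbitrary sequences of letters and bars. -/
inductive ExtMMove {α : Type*} {n : ℕ} (D : ExtHomotopyData α) :
    Nanophrase.{u} α n → Nanophrase.{u} α n → Prop
  /-- isomorphism: a bijection of alphabets that preserves projections and components -/
  | iso (p p' : Nanophrase.{u} α n) (f : p.Letter ≃ p'.Letter)
      (hproj : ∀ A, p'.proj (f A) = p.proj A)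
      (hword : ∀ k, p'.word k = (p.word k).map f) :
      ExtMMove D p p'
  /-- `(𝒜, xAAy) ⟶ (𝒜 - {A}, xy)` -/
  | h1 (p p' : Nanophrase.{u} α n) (A : p.Letter)
      (f : p'.Letter ≃ {X : p.Letter // X ≠ A})
      (hproj : ∀ X, p'.proj X = p.proj (f X))
      (x y : List (Token p.Letter))
      (hp : flatPhrase p.word = x ++ [.letter A, .letter A] ++ y)
      (hp' : (flatPhrase p'.word).map (Token.map fun X => (f X : p.Letter)) = x ++ y) :
      ExtMMove D p p'
  /-- `(𝒜, xAByBAz) ⟶ (𝒜 - {A, B}, xyz)` if `τ(|A|) = |B|` -/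
  | h2 (p p' : Nanophrase.{u} α n) (A B : p.Letter)
      (hτ : D.τ (p.proj A) = p.proj B)
      (f : p'.Letter ≃ {X : p.Letter // X ≠ A ∧ X ≠ B})
      (hproj : ∀ X, p'.proj X = p.proj (f X))
      (x y z : List (Token p.Letter))
      (hp : flatPhrase p.word =
        x ++ [.letter A, .letter B] ++ y ++ [.letter B, .letter A] ++ z)
      (hp' : (flatPhrase p'.word).map (Token.map fun X => (f X : p.Letter)) = x ++ y ++ z) :
      ExtMMove D p p'
  /-- `(𝒜, xAByACzBCt) ⟶ (𝒜, xBAyCAzCBt)` if `(|A|, |B|, |C|) ∈ S'`, where each of `A`, `B`, `C`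
  is a letter or the empty word. If none is empty, this is the usual third move. -/
  | h3 (L : Type u) [DecidableEq L] (proj : L → α) (w w' : Fin n → List L)
      (hw : IsGauss w) (hw' : IsGauss w') (A B C : Option L)
      (hS : (A.map proj, B.map proj, C.map proj) ∈ D.S')
      (x y z t : List (Token L))
      (hp : flatPhrase w =
        x ++ Token.ofOption A ++ Token.ofOption B ++ y ++ Token.ofOption A ++ Token.ofOption C ++
          z ++ Token.ofOption B ++ Token.ofOption C ++ t)
      (hp' : flatPhrase w' =
        x ++ Token.ofOption B ++ Token.ofOption A ++ y ++ Token.ofOption C ++ Token.ofOption A ++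
          z ++ Token.ofOption C ++ Token.ofOption B ++ t) :
      ExtMMove D ⟨L, proj, w, hw⟩ ⟨L, proj, w', hw'⟩
  /-- self crossing move: a letter that occurs twice in one component changes its projection
  by `σ` -/
  | selfCrossing (L : Type u) [DecidableEq L] (proj : L → α) (w : Fin n → List L)
      (hw : IsGauss w) (k : Fin n) (A : L) (x y z : List L)
      (hk : w k = x ++ [A] ++ y ++ [A] ++ z) :
      ExtMMove D ⟨L, proj, w, hw⟩ ⟨L, Function.update proj A (D.σ (proj A)), w, hw⟩
  /-- shift move: the component `Ax` becomes `xA`, and `|A|` becomes `ν(|A|)` if `x` contains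
  `A`; other projections and components do not change -/
  | shift (L : Type u) [DecidableEq L] (proj : L → α) (w w' : Fin n → List L)
      (hw : IsGauss w) (hw' : IsGauss w') (k : Fin n) (A : L) (x : List L)
      (hk : w k = A :: x) (hk' : w' = Function.update w k (x ++ [A])) :
      ExtMMove D ⟨L, proj, w, hw⟩
        ⟨L, if A ∈ x then Function.update proj A (D.ν (proj A)) else proj, w', hw'⟩

/-- Extended `M`-homotopy: the equivalence relation generated by the moves. -/
def ExtMHomotopic {α : Type*} {n : ℕ} (D : ExtHomotopyData α) :
    Nanophrase.{u} α n → Nanophrase.{u} α n → Prop :=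
  Relation.EqvGen (ExtMMove D)

/-! ### The homotopy data of welded links -/

/-- The set `α_v = {a₊, a₋, b₊, b₋}`. -/
inductive AlphaV : Type
  | ap | am | bp | bm

namespace AlphaV

/-- `τ_v`: `a₊ ↔ b₋`, `a₋ ↔ b₊`. -/
def tau : AlphaV → AlphaV
  | ap => bm | bm => ap | am => bp | bp => am

/-- `ν_v`: `a₊ ↔ b₊`, `a₋ ↔ b₋`. -/
def nu : AlphaV → AlphaV
  | ap => bp | bp => ap | am => bm | bm => am

/-- `σ_v`: `a₊ ↔ a₋`, `b₊ ↔ b₋`. -/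
def sigma : AlphaV → AlphaV
  | ap => am | am => ap | bp => bm | bm => bp

/-- The set `S'_w`. -/
def weldedTriples : Set (Option AlphaV × Option AlphaV × Option AlphaV) :=
  { (some ap, some ap, some ap), (some ap, some ap, some am), (some ap, some am, some am),
    (some am, some am, some am), (some am, some am, some ap), (some am, some ap, some ap),
    (some bp, some bp, some bp), (some bp, some bp, some bm), (some bp, some bm, some bm),
    (some bm, some bm, some bm), (some bm, some bm, some bp), (some bm, some bp, some bp),
    (some ap, some ap, none), (some ap, some bm, none),
    (some bm, some ap, none), (some bm, some bm, none),
    (some am, none, some bm), (some bp, none, some ap),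
    (some am, none, some ap), (some bp, none, some bm),
    (none, some am, some am), (none, some am, some bp),
    (none, some bp, some am), (none, some bp, some bp) }

end AlphaV

/-- The data `(α_v, τ_v, S'_w)`, `ν_v`, `σ_v`. -/
def weldedData : ExtHomotopyData AlphaV where
  τ := AlphaV.tau
  ν := AlphaV.nu
  σ := AlphaV.sigma
  τ_invol := by intro a; cases a <;> rfl
  ν_invol := by intro a; cases a <;> rfl
  σ_invol := by intro a; cases a <;> rfl
  S' := AlphaV.weldedTriples

/-! ### Words on an alphabet and its formal inverses -/

/-- Words on `L ∪ L⁻¹`; the pair `(A, true)` is `A` and `(A, false)` is `A⁻¹`. There is no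
cancellation. -/
abbrev SignedWord (L : Type*) := List (L × Bool)

/-- `(A₁⋯Aₘ)⁻¹ = Aₘ⁻¹⋯A₁⁻¹`. -/
def SignedWord.inv {L : Type*} (w : SignedWord L) : SignedWord L :=
  (w.map fun a => (a.1, !a.2)).reverse

namespace Nanophrase

variable {n : ℕ} (p : Nanophrase.{u} AlphaV n)

/-- The sign `ε` of an occurrence of the letter `A` in the component `i`. It is nonzero only
if the other occurrence of `A` is in another component `k`, and then it depends on `|A|` and on
whether `i < k` or `k < i`. -/
def sign (i : Fin n) (A : p.Letter) : SignType :=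
  if ∃ k, i < k ∧ A ∈ p.word k then
    match p.proj A with
    | .bp => 1
    | .am => -1
    | _ => 0
  else if ∃ k, k < i ∧ A ∈ p.word k then
    match p.proj A with
    | .ap => 1
    | .bm => -1
    | _ => 0
  else 0

/-- The word obtained from a piece `w` of the component `i` by giving each letter `A` the exponent
`ε` (letters with exponent `0` disappear). -/
def signedWord (i : Fin n) (w : List p.Letter) : SignedWord p.Letter :=
  w.flatMap fun A =>
    match p.sign i A with
    | .pos => [(A, true)]
    | .neg => [(A, false)]
    | .zero => []

/-- The components in which `A` occurs. -/
def support (A : p.Letter) : Finset (Fin n) :=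
  Finset.univ.filter fun k => A ∈ p.word k

theorem support_nonempty (A : p.Letter) : (p.support A).Nonempty := by
  have hA : A ∈ (List.ofFn p.word).flatten := List.count_pos_iff.1 (by rw [p.gauss A]; omega)
  obtain ⟨l, hl, hAl⟩ := List.mem_flatten.1 hA
  obtain ⟨k, rfl⟩ := (List.mem_ofFn' _ _).1 hl
  exact ⟨k, by simp [support, hAl]⟩

/-- The index `k` with `η(A) = a_k`: the component of the second occurrence of `A` if `|A|` is `b₊`
or `a₋`, and of the first one if `|A|` is `a₊` or `b₋`. -/
def eta (A : p.Letter) : Fin n :=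
  match p.proj A with
  | .bp | .am => (p.support A).max' (p.support_nonempty A)
  | .ap | .bm => (p.support A).min' (p.support_nonempty A)

/-- The map `η` on words, with values in the words on `a₁^{±1}, …, aₙ^{±1}`. -/
def etaWord (w : SignedWord p.Letter) : SignedWord (Fin n) :=
  w.map fun a => (p.eta a.1, a.2)

/-- The signed word `x` before the occurrence of `A` with sign zero: if `A` occurs with nonzero sign
in the component `i`, its other occurrence is in the component `k = η(A) ≠ i`, and `x` is the
truncation of the signed `k`-th component at that occurrence. -/
def before (A : p.Letter) : SignedWord p.Letter :=
  p.signedWord (p.eta A) ((p.word (p.eta A)).takeWhile fun X => X ≠ A)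

/-- The map `ρ^q` (it matters only for `q ≥ 2`): `ρ²` is the identity, and `ρ^q` replaces each
signed letter `A^{±1}` by `ρ^{q-1}(x⁻¹) A^{±1} ρ^{q-1}(x)`. -/
def rho : ℕ → SignedWord p.Letter → SignedWord p.Letter
  | q + 3, w => w.flatMap fun a =>
      rho (q + 2) (p.before a.1).inv ++ [a] ++ rho (q + 2) (p.before a.1)
  | _, w => w

end Nanophrase

/-! ### Noncommutative power series and the expansion -/

/-- The formal power series with integer coefficients in the noncommuting variables `κ₁, …, κₙ`; the
value at `[c₁, …, c_u]` is the coefficient of `κ_{c₁}⋯κ_{c_u}`. -/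
abbrev NCSeries (n : ℕ) := List (Fin n) → ℤ

namespace NCSeries

variable {n : ℕ}

/-- The series `1`. -/
def one : NCSeries n := fun c => if c = [] then 1 else 0

/-- The product of noncommutative series. -/
def mul (f g : NCSeries n) : NCSeries n := fun c =>
  ∑ j ∈ Finset.range (c.length + 1), f (c.take j) * g (c.drop j)

/-- `φ(a_h) = 1 + κ_h` and `φ(a_h⁻¹) = 1 - κ_h + κ_h² - ⋯`. -/
def phiLetter (a : Fin n × Bool) : NCSeries n := fun c =>
  if a.2 = true then (if c = [] ∨ c = [a.1] then 1 else 0)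
  else (if c = List.replicate c.length a.1 then (-1) ^ c.length else 0)

/-- The multiplicative map `φ` from words on `a₁^{±1}, …, aₙ^{±1}` to series. -/
def phi : SignedWord (Fin n) → NCSeries n
  | [] => one
  | a :: w => mul (phiLetter a) (phi w)

end NCSeries

namespace Nanophrase

variable {n : ℕ} (p : Nanophrase.{u} AlphaV n)

/-- The series `φ ∘ η (ρ^q(w_i^ε))`. -/
def expansion (q : ℕ) (i : Fin n) : NCSeries n :=
  NCSeries.phi (p.etaWord (p.rho q (p.signedWord i (p.word i))))

/-- `μ(p; c₁, …, c_u, i)`: the limit for `q → ∞` of the coefficient of `κ_{c₁}⋯κ_{c_u}` in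
`φ ∘ η (ρ^q(w_i^ε))`. It exists, see `Nanophrase.expansion_eq_mu`. -/
noncomputable def mu (c : List (Fin n)) (i : Fin n) : ℤ :=
  Filter.limUnder Filter.atTop fun q => p.expansion q i c

/-- `μ(p; d₁, …, d_t)`, where the last index `d_t` is in the place of `i`
(the value at the empty sequence is never used). -/
noncomputable def muSeq (d : List (Fin n)) : ℤ :=
  match d.getLast? with
  | some i => p.mu d.dropLast i
  | none => 0

/-- The sequences of length at least two that arise from `s` by eliminating at least one index
and permuting the remaining ones cyclically. -/
def lowerSequences (s : List (Fin n)) : Finset (List (Fin n)) :=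
  (((s.sublists.filter fun d => d.length < s.length).flatMap
    List.cyclicPermutations).filter fun d => 2 ≤ d.length).toFinset

/-- `Δ(p; c₁, …, c_u, i)`: the greatest common divisor of the lower `μ`'s; it is `0` for `u = 1`. -/
noncomputable def delta (c : List (Fin n)) (i : Fin n) : ℤ :=
  (lowerSequences (c ++ [i])).gcd p.muSeq

/-- `μ̄(p; c₁, …, c_u, i)`: the residue class of `μ(p; c₁, …, c_u, i)` modulo
`Δ(p; c₁, …, c_u, i)`, as a set of integers. -/
def mubar (c : List (Fin n)) (i : Fin n) : Set ℤ :=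
  {m | m ≡ p.mu c i [ZMOD p.delta c i]}

end Nanophrase

/-! ### Convergence of the coefficients -/

namespace NCSeries

variable {n : ℕ}

theorem mul_nil (f g : NCSeries n) : mul f g [] = f [] * g [] := by simp [mul]

theorem mul_cons (f g : NCSeries n) (a : Fin n) (c : List (Fin n)) :
    mul f g (a :: c) = f [] * g (a :: c) + mul (fun d => f (a :: d)) g c := by
  simp only [mul, List.length_cons]
  rw [Finset.sum_range_succ', add_comm]
  simp

theorem add_mul (f f' g : NCSeries n) : mul (f + f') g = mul f g + mul f' g := by
  funext c
  simp [mul, _root_.add_mul, Finset.sum_add_distrib]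

theorem mul_add (f g g' : NCSeries n) : mul f (g + g') = mul f g + mul f g' := by
  funext c
  simp [mul, _root_.mul_add, Finset.sum_add_distrib]

theorem smul_mul (a : ℤ) (f g : NCSeries n) : mul (fun d => a * f d) g = fun d => a * mul f g d := by
  funext c
  simp [mul, Finset.mul_sum, mul_assoc]

theorem zero_mul (g : NCSeries n) : mul (fun _ => 0) g = fun _ => 0 := by
  funext c
  simp [mul]

theorem one_mul (f : NCSeries n) : mul one f = f := by
  funext c
  cases c with
  | nil => simp [mul_nil, one]
  | cons a c =>
    have h : (fun d => one (a :: d) : NCSeries n) = fun _ => 0 := by funext d; simp [one]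
    rw [mul_cons, h, zero_mul]
    simp [one]

theorem mul_one (f : NCSeries n) : mul f one = f := by
  funext c
  induction c generalizing f with
  | nil => simp [mul_nil, one]
  | cons a c ih => rw [mul_cons, ih]; simp [one]

theorem mul_assoc (f g h : NCSeries n) : mul (mul f g) h = mul f (mul g h) := by
  funext c
  induction c generalizing f with
  | nil => simp [mul_nil, _root_.mul_assoc]
  | cons a c ih =>
    have e : (fun d => mul f g (a :: d) : NCSeries n) =
        (fun d => f [] * g (a :: d)) + mul (fun d => f (a :: d)) g := by
      funext d; simp [mul_cons]
    rw [mul_cons, e, add_mul, mul_cons, mul_cons g, Pi.add_apply, ih, mul_nil,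
      smul_mul (f []) (fun d => g (a :: d)) h]
    ring

theorem phi_append (w w' : SignedWord (Fin n)) : phi (w ++ w') = mul (phi w) (phi w') := by
  induction w with
  | nil => simp [phi, one_mul]
  | cons a w ih => simp [phi, ih, mul_assoc]

theorem phiLetter_nil (a : Fin n × Bool) : phiLetter a [] = 1 := by
  simp [phiLetter]

theorem phiLetter_inv_mul (a : Fin n × Bool) :
    mul (phiLetter (a.1, !a.2)) (phiLetter a) = one := by
  obtain ⟨h, b⟩ := a
  have key : ∀ a : Fin n, ∀ b : Bool, (fun d => phiLetter (h, b) (a :: d) : NCSeries n) =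
      if a = h then (if b then one else fun d => (-1) * phiLetter (h, false) d)
      else fun _ => 0 := by
    intro a b
    funext d
    by_cases ha : a = h
    · cases b <;> simp [phiLetter, one, ha, List.replicate_succ, pow_succ]
    · cases b <;> simp [phiLetter, ha, List.replicate_succ]
  funext c
  induction c with
  | nil => simp [mul_nil, phiLetter_nil, one]
  | cons a c ih =>
    rw [mul_cons, key, phiLetter_nil]
    have k2 := congrFun (key a b) c
    dsimp only at k2 ih ⊢
    rw [k2]
    by_cases ha : a = h
    · cases b
      · simp [ha, one_mul, one]
      · simp only [Bool.not_true] at ih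
        have h2 : mul (fun d => (-1) * phiLetter (h, false) d) (phiLetter (h, true)) c =
            (-1) * one c := by rw [smul_mul]; dsimp only; rw [ih]
        simp only [ha, if_true, Bool.not_true, Bool.false_eq_true, if_false]
        rw [h2]
        by_cases hc : c = [] <;> simp [one, hc]
    · simp [ha, zero_mul, one]

theorem phi_inv_mul (w : SignedWord (Fin n)) : mul (phi w.inv) (phi w) = one := by
  induction w with
  | nil => simp [SignedWord.inv, phi, one_mul]
  | cons a w ih =>
    have e : SignedWord.inv (a :: w) = SignedWord.inv w ++ [(a.1, !a.2)] := by
      simp [SignedWord.inv]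
    rw [e, phi_append]
    simp only [phi, mul_one]
    rw [mul_assoc, ← mul_assoc _ (phiLetter a), phiLetter_inv_mul, one_mul, ih]

/-- Two series agree in all degrees less than `d`. -/
def AgreeBelow (d : ℕ) (f g : NCSeries n) : Prop :=
  ∀ c : List (Fin n), c.length < d → f c = g c

theorem AgreeBelow.mul {d : ℕ} {f f' g g' : NCSeries n} (hf : AgreeBelow d f f')
    (hg : AgreeBelow d g g') : AgreeBelow d (mul f g) (mul f' g') := by
  intro c hc
  refine Finset.sum_congr rfl fun j _ => ?_
  rw [hf _ (by simp; omega), hg _ (by simp; omega)]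

/-- If `N` has no constant term, `Y N X` is determined below degree `d + 1` by `X`, `Y` below
degree `d`. -/
theorem AgreeBelow.conj {d : ℕ} {X X' Y Y' N : NCSeries n} (hN : N [] = 0)
    (hX : AgreeBelow d X X') (hY : AgreeBelow d Y Y') :
    AgreeBelow (d + 1) (NCSeries.mul Y (NCSeries.mul N X))
      (NCSeries.mul Y' (NCSeries.mul N X')) := by
  have h1 : AgreeBelow (d + 1) (NCSeries.mul N X) (NCSeries.mul N X') := by
    intro c hc
    refine Finset.sum_congr rfl fun j _ => ?_
    rcases Nat.eq_zero_or_pos j with rfl | hj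
    · simp [hN]
    · rcases Nat.eq_zero_or_pos c.length with h0 | h0
      · have : c = [] := List.length_eq_zero_iff.1 h0
        subst this; simp [hN]
      · rw [hX _ (by simp; omega)]
  intro c hc
  refine Finset.sum_congr rfl fun j hj => ?_
  have hj' : j ≤ c.length := by simpa [Nat.lt_succ_iff] using hj
  rw [h1 _ (by simp; omega)]
  rcases Nat.lt_or_ge j c.length with h | h
  · rw [hY _ (by simp; omega)]
  · have : c.drop j = [] := List.drop_eq_nil_of_le h
    rw [this, mul_nil, hN]
    simp

end NCSeries

namespace Nanophrase

open NCSeries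

variable {n : ℕ} (p : Nanophrase.{u} AlphaV n)

theorem etaWord_inv (w : SignedWord p.Letter) : p.etaWord w.inv = (p.etaWord w).inv := by
  simp [etaWord, SignedWord.inv]

theorem etaWord_append (w w' : SignedWord p.Letter) :
    p.etaWord (w ++ w') = p.etaWord w ++ p.etaWord w' := by
  simp [etaWord]

theorem inv_append {L : Type*} (w w' : SignedWord L) :
    SignedWord.inv (w ++ w') = SignedWord.inv w' ++ SignedWord.inv w := by
  simp [SignedWord.inv]

theorem inv_inv {L : Type*} (w : SignedWord L) : w.inv.inv = w := by
  simp [SignedWord.inv, Function.comp_def]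

theorem rho_cons (q : ℕ) (a : p.Letter × Bool) (w : SignedWord p.Letter) :
    p.rho q (a :: w) = p.rho q [a] ++ p.rho q w := by
  match q with
  | 0 | 1 | 2 => simp [rho]
  | q + 3 => simp [rho]

theorem rho_nil (q : ℕ) : p.rho q [] = [] := by
  match q with
  | 0 | 1 | 2 => simp [rho]
  | q + 3 => simp [rho]

theorem rho_append (q : ℕ) (w w' : SignedWord p.Letter) :
    p.rho q (w ++ w') = p.rho q w ++ p.rho q w' := by
  induction w with
  | nil => simp [rho_nil]
  | cons a w ih => rw [List.cons_append, rho_cons, ih, rho_cons p q a w, List.append_assoc]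

theorem rho_inv (q : ℕ) (w : SignedWord p.Letter) : p.rho q w.inv = (p.rho q w).inv := by
  induction q using Nat.strong_induction_on generalizing w with
  | _ q ihq =>
    match q with
    | 0 | 1 | 2 => simp [rho]
    | q + 3 =>
      induction w with
      | nil => simp [SignedWord.inv, rho_nil]
      | cons a w ih =>
        have e : SignedWord.inv (a :: w) = SignedWord.inv w ++ [(a.1, !a.2)] := by
          simp [SignedWord.inv]
        rw [e, rho_append, ih, rho_cons p _ a w, inv_append]
        congr 1
        simp only [rho, List.flatMap_cons, List.flatMap_nil, List.append_nil]
        rw [inv_append, inv_append, ihq (q + 2) (by omega), inv_inv, List.append_assoc]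
        simp [SignedWord.inv]

/-- Below degree `q`, the expansions of `ρ^q` and `ρ^{q+1}` agree. -/
theorem agreeBelow_rho (q : ℕ) (hq : 2 ≤ q) (w : SignedWord p.Letter) :
    AgreeBelow q (phi (p.etaWord (p.rho (q + 1) w))) (phi (p.etaWord (p.rho q w))) := by
  -- the expansion of one signed letter
  have key : ∀ r, 2 ≤ r → ∀ a : p.Letter × Bool, phi (p.etaWord (p.rho (r + 1) [a])) =
      NCSeries.one + NCSeries.mul (phi (p.etaWord (p.rho r (p.before a.1))).inv)
        (NCSeries.mul (phiLetter (p.eta a.1, a.2) - NCSeries.one)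
          (phi (p.etaWord (p.rho r (p.before a.1))))) := by
    intro r hr a
    obtain ⟨r, rfl⟩ := Nat.exists_eq_add_of_le' hr
    have e : p.rho (r + 2 + 1) [a] =
        p.rho (r + 2) (p.before a.1).inv ++ ([a] ++ p.rho (r + 2) (p.before a.1)) := by
      simp [rho]
    rw [e, etaWord_append, etaWord_append, rho_inv, etaWord_inv, phi_append, phi_append]
    set X := p.etaWord (p.rho (r + 2) (p.before a.1))
    have e2 : phi (p.etaWord [a]) =
        NCSeries.one + (phiLetter (p.eta a.1, a.2) - NCSeries.one) := by
      simp [etaWord, phi, NCSeries.mul_one]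
    rw [e2, NCSeries.add_mul, NCSeries.one_mul, NCSeries.mul_add, phi_inv_mul]
  induction q, hq using Nat.le_induction generalizing w with
  | base =>
    induction w with
    | nil => simp only [rho_nil]; exact fun _ _ => rfl
    | cons a w ih =>
      rw [rho_cons, rho_cons p 2, etaWord_append, etaWord_append, phi_append, phi_append]
      refine AgreeBelow.mul ?_ ih
      rw [key 2 le_rfl]
      have e2 : phi (p.etaWord (p.rho 2 [a])) = NCSeries.one + NCSeries.mul NCSeries.one
          (NCSeries.mul (phiLetter (p.eta a.1, a.2) - NCSeries.one) NCSeries.one) := by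
        simp [rho, etaWord, phi, NCSeries.mul_one, NCSeries.one_mul]
      rw [e2]
      have h0 : ∀ w : SignedWord (Fin n), AgreeBelow 1 (phi w) NCSeries.one := by
        intro w c hc
        have : c = [] := List.length_eq_zero_iff.1 (by omega)
        subst this
        induction w with
        | nil => rfl
        | cons a w ih => simp [phi, NCSeries.mul_nil, phiLetter_nil, ih, NCSeries.one]
      have h := AgreeBelow.conj (N := phiLetter (p.eta a.1, a.2) - NCSeries.one)
        (by simp [phiLetter_nil, NCSeries.one])
        (h0 (p.etaWord (p.rho 2 (p.before a.1)))) (h0 (p.etaWord (p.rho 2 (p.before a.1))).inv)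
      intro c hc
      simp only [Pi.add_apply]
      rw [h c hc]
  | succ q hq ihq =>
    induction w with
    | nil => simp only [rho_nil]; exact fun _ _ => rfl
    | cons a w ih =>
      rw [rho_cons, rho_cons p (q + 1), etaWord_append, etaWord_append, phi_append, phi_append]
      refine AgreeBelow.mul ?_ ih
      rw [key (q + 1) (by omega), key q hq]
      have hX := ihq (p.before a.1)
      have hY := ihq (p.before a.1).inv
      rw [rho_inv, rho_inv, etaWord_inv, etaWord_inv] at hY
      have h := AgreeBelow.conj (N := phiLetter (p.eta a.1, a.2) - NCSeries.one)
        (by simp [phiLetter_nil, NCSeries.one]) hX hY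
      intro c hc
      simp only [Pi.add_apply]
      rw [h c hc]

/-- The coefficients converge (they are eventually constant), so `mu` is their limit. -/
theorem expansion_eq_mu (c : List (Fin n)) (i : Fin n) (q : ℕ) (hq : 2 ≤ q)
    (hc : c.length < q) : p.expansion q i c = p.mu c i := by
  have hconst : ∀ r, q ≤ r → p.expansion r i c = p.expansion q i c := by
    intro r hr
    induction r, hr using Nat.le_induction with
    | base => rfl
    | succ r hr ih =>
      rw [← ih]
      exact p.agreeBelow_rho r (by omega) _ c (by omega)
  have ht : Filter.Tendsto (fun r => p.expansion r i c) Filter.atTop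
      (nhds (p.expansion q i c)) :=
    tendsto_const_nhds.congr' (Filter.eventually_atTop.2 ⟨q, fun r hr => (hconst r hr).symm⟩)
  exact ht.limUnder_eq.symm

end Nanophrase

/-!
Let `g k` be elements of a group `G`, each of which commutes with all its conjugates. A coloring of
a nanophrase gives to each letter a conjugate of the element `g k` of the component `k` in which it
passes over: the conjugate by the signed product of the values of the letters that precede it
there. The longitudes of a coloring are the signed products along the components. If `G` is
nilpotent, then a coloring exists, and the words `ρ^q` evaluate to its longitudes for large `q`.

All moves but the shift transport colorings and preserve the class of the `k`-th longitude modulo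
the normal closure of `g k`. The shift conjugates `g k` and the `k`-th longitude, and it transports
colorings if `g k` commutes with the `k`-th longitude.

For distinct `c₁, …, c_u`, let `G` be the unitriangular matrices indexed by the gaps of this list,
and `g k = 1 + κ_k`, where `κ_{c_j}` is the elementary matrix from the gap before `c_j` to the gap
behind it, and `κ_k = 0` if `k` is not in the list. The entries of a matrix that evaluates a word
are the coefficients of its expansion at the monomials without repetitions along the list, so the
corner entry of the `i`-th longitude is `μ(c₁, …, c_u, i)`. As `g i = 1` for the index `i`, this
number is preserved by all moves but the shift. Over a ring in which the lower coefficients vanish,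
`g k` commutes with the `k`-th longitude, and the `i`-th longitude is central, so the shift does not
change its corner entry.
-/

/-! ### Evaluation of signed words in a group -/

namespace SignedWord

variable {L L' G H : Type*} [Group G] [Group H]

/-- The product of the values of the letters of a signed word in a group. -/
def eval (m : L → G) (w : SignedWord L) : G :=
  (w.map fun a => if a.2 then m a.1 else (m a.1)⁻¹).prod

@[simp]
theorem eval_nil (m : L → G) : eval m [] = 1 := rfl

theorem eval_cons (m : L → G) (a : L × Bool) (w : SignedWord L) :
    eval m (a :: w) = (if a.2 then m a.1 else (m a.1)⁻¹) * eval m w := by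
  simp [eval]

theorem eval_append (m : L → G) (w w' : SignedWord L) :
    eval m (w ++ w') = eval m w * eval m w' := by
  simp [eval]

theorem eval_inv (m : L → G) (w : SignedWord L) : eval m w.inv = (eval m w)⁻¹ := by
  have hfun : ((fun a : L × Bool => if a.2 then m a.1 else (m a.1)⁻¹) ∘ fun a => (a.1, !a.2)) =
      (fun g => g⁻¹) ∘ fun a : L × Bool => if a.2 then m a.1 else (m a.1)⁻¹ := by
    funext ⟨A, b⟩
    cases b <;> simp
  rw [eval, eval, SignedWord.inv, List.prod_inv_reverse, List.map_reverse, List.map_map,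
    List.map_map, hfun]

theorem map_eval (f : G →* H) (m : L → G) (w : SignedWord L) :
    f (eval m w) = eval (fun A => f (m A)) w := by
  simp only [eval, map_list_prod, List.map_map, Function.comp_def, apply_ite f, map_inv]

theorem eval_congr {m m' : L → G} {w : SignedWord L} (h : ∀ a ∈ w, m a.1 = m' a.1) :
    eval m w = eval m' w := by
  refine congrArg List.prod (List.map_congr_left fun a ha => ?_)
  rw [h a ha]

end SignedWord

/-! ### Substitution in the expansion -/

namespace NCSeries

variable {n : ℕ}

/-- The product `κ_a f`. -/
def kappaMul (a : Fin n) (f : NCSeries n) : NCSeries n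
  | [] => 0
  | e :: d => if e = a then f d else 0

theorem mul_phiLetter_true (a : Fin n) (f : NCSeries n) :
    mul (phiLetter (a, true)) f = f + kappaMul a f := by
  funext c
  match c with
  | [] => simp [mul_nil, phiLetter_nil, kappaMul]
  | e :: d =>
    have htail : (fun d => phiLetter (a, true) (e :: d) : NCSeries n) =
        if e = a then one else fun _ => 0 := by
      split_ifs with he <;> funext d <;> simp [phiLetter, one, he]
    rw [mul_cons, htail, phiLetter_nil]
    split_ifs with he <;> simp [kappaMul, he, one_mul, zero_mul]

theorem phi_cons_true (a : Fin n) (w : SignedWord (Fin n)) :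
    phi ((a, true) :: w) = phi w + kappaMul a (phi w) :=
  mul_phiLetter_true a (phi w)

theorem phi_cons_false (a : Fin n) (w : SignedWord (Fin n)) :
    phi ((a, false) :: w) + kappaMul a (phi ((a, false) :: w)) = phi w := by
  rw [← mul_phiLetter_true, phi, ← mul_assoc]
  exact (congrArg (mul · (phi w)) (phiLetter_inv_mul (a, false))).trans (one_mul _)

section Subst

variable {S : Type*} [Ring S]

/-- The value of a series at `κ_k = T k`, for `T` such that only finitely many monomials do not
vanish at `T`. -/
noncomputable def subst (T : Fin n → S) (f : NCSeries n) : S :=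
  ∑ᶠ d, (f d : S) * (d.map T).prod

variable {T : Fin n → S} (hT : {d : List (Fin n) | (d.map T).prod ≠ 0}.Finite)

include hT

theorem finite_support_subst (f : NCSeries n) :
    (Function.support fun d => (f d : S) * (d.map T).prod).Finite :=
  hT.subset fun _ hd => right_ne_zero_of_mul hd

theorem subst_add (f g : NCSeries n) : subst T (f + g) = subst T f + subst T g := by
  rw [subst, subst, subst,
    ← finsum_add_distrib (finite_support_subst hT f) (finite_support_subst hT g)]
  simp only [Pi.add_apply, Int.cast_add, _root_.add_mul]

theorem subst_kappaMul (a : Fin n) (f : NCSeries n) :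
    subst T (kappaMul a f) = T a * subst T f := by
  have hsupp : (Function.support fun d => (kappaMul a f d : S) * (d.map T).prod) ⊆
      Set.range (List.cons a) := by
    rintro (_ | ⟨e, d⟩) hd
    · simp [kappaMul] at hd
    · by_cases he : e = a
      · exact ⟨d, by rw [he]⟩
      · simp [kappaMul, he] at hd
  rw [subst, subst, mul_finsum' _ _ (finite_support_subst hT f),
    ← Set.indicator_eq_self.2 hsupp, ← finsum_mem_def, finsum_mem_range List.cons_injective]
  refine finsum_congr fun d => ?_
  simp only [kappaMul, if_true, List.map_cons, List.prod_cons, ← _root_.mul_assoc,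
    (Int.cast_commute _ _).eq]

omit hT in
theorem subst_one : subst T one = 1 := by
  rw [subst, finsum_eq_single _ [] fun d hd => by simp [one, hd]]
  simp [one]

theorem map_eval_eq_subst {G : Type*} [Group G] (F : G →* S) (g : Fin n → G)
    (hF : ∀ k, F (g k) = 1 + T k) (w : SignedWord (Fin n)) :
    F (SignedWord.eval g w) = subst T (phi w) := by
  induction w with
  | nil => rw [SignedWord.eval_nil, map_one, phi, subst_one]
  | cons a w ih =>
    obtain ⟨a, b⟩ := a
    cases b
    · rw [SignedWord.eval_cons, if_neg Bool.false_ne_true, map_mul, ih, ← phi_cons_false,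
        subst_add hT, subst_kappaMul hT, ← one_add_mul, ← hF, ← _root_.mul_assoc, ← map_mul,
        inv_mul_cancel, map_one, _root_.one_mul]
    · rw [SignedWord.eval_cons, if_pos rfl, map_mul, ih, phi_cons_true, subst_add hT,
        subst_kappaMul hT, hF, one_add_mul]

end Subst

end NCSeries

/-! ### Matrices indexed by the gaps of a list -/

/-- Square matrices with rows and columns indexed by the gaps of the list `c`. -/
abbrev GapMatrix {n : ℕ} (c : List (Fin n)) (R : Type*) :=
  Matrix (Fin (c.length + 1)) (Fin (c.length + 1)) R

/-- The part of the list `c` between the gaps `a` and `b`. -/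
def gapInterval {n : ℕ} (c : List (Fin n)) (a b : ℕ) : List (Fin n) := (c.take b).drop a

section GapInterval

variable {n : ℕ} (c : List (Fin n))

theorem gapInterval_append {a m b : ℕ} (h1 : a ≤ m) (h2 : m ≤ b) :
    gapInterval c a m ++ gapInterval c m b = gapInterval c a b := by
  obtain ⟨i, rfl⟩ := Nat.exists_eq_add_of_le h1
  obtain ⟨j, rfl⟩ := Nat.exists_eq_add_of_le h2
  simp only [gapInterval, List.drop_take, Nat.add_sub_cancel_left]
  rw [show a + i + j - a = i + j by omega, List.take_add, List.drop_drop]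

theorem length_gapInterval {a b : ℕ} (h : b ≤ c.length) :
    (gapInterval c a b).length = b - a := by
  simp [gapInterval, h]

theorem gapInterval_self (a : ℕ) : gapInterval c a a = [] :=
  List.drop_eq_nil_of_le (by simp)

theorem gapInterval_zero_length : gapInterval c 0 c.length = c := by
  simp [gapInterval]

theorem gapInterval_sublist (a b : ℕ) : (gapInterval c a b).Sublist c :=
  (List.drop_sublist _ _).trans (List.take_sublist _ _)

variable {c}

theorem gapInterval_eq_append_iff {a b : ℕ} (hab : a ≤ b) (hb : b ≤ c.length)
    {d e : List (Fin n)} :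
    gapInterval c a b = d ++ e ↔ a + d.length ≤ b ∧
      gapInterval c a (a + d.length) = d ∧ gapInterval c (a + d.length) b = e := by
  refine ⟨fun h => ?_, fun ⟨hle, hd, he⟩ => ?_⟩
  · have hlen := congrArg List.length h
    rw [length_gapInterval c hb, List.length_append] at hlen
    have hle : a + d.length ≤ b := by omega
    rw [← gapInterval_append c (Nat.le_add_right a d.length) hle] at h
    exact ⟨hle, List.append_inj h (by rw [length_gapInterval c (by omega)]; omega)⟩
  · conv_rhs => rw [← hd, ← he]
    exact (gapInterval_append c (Nat.le_add_right _ _) hle).symm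

end GapInterval

/-- The matrix of the monomial `κ_{d₁}⋯κ_{d_t}`: its nonzero entries are at the pairs of gaps that
enclose the list `d`. -/
def monomialMatrix {n : ℕ} (c : List (Fin n)) (R : Type*) [CommRing R] (d : List (Fin n)) :
    GapMatrix c R :=
  fun a b => if a ≤ b ∧ gapInterval c a b = d then 1 else 0

/-- The matrix of the variable `κ_k`. -/
abbrev kappa {n : ℕ} (c : List (Fin n)) (R : Type*) [CommRing R] (k : Fin n) : GapMatrix c R :=
  monomialMatrix c R [k]

/-- The nonzero entries of `Y` are on or above the diagonal, at places where the part of the list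
between the two gaps satisfies `P`. -/
def Supported {n : ℕ} {c : List (Fin n)} {R : Type*} [CommRing R] (P : List (Fin n) → Prop)
    (Y : GapMatrix c R) : Prop :=
  ∀ a b, Y a b ≠ 0 → a ≤ b ∧ P (gapInterval c a b)

/-- The matrices that vanish below the `d`-th superdiagonal. -/
abbrev DegreeGE {n : ℕ} {c : List (Fin n)} {R : Type*} [CommRing R] (d : ℕ) :
    GapMatrix c R → Prop :=
  Supported fun x => d ≤ x.length

section GapMatrix

variable {n : ℕ} {c : List (Fin n)} {R : Type*} [CommRing R]

theorem monomialMatrix_nil : monomialMatrix c R [] = 1 := by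
  ext a b
  have h : (a ≤ b ∧ gapInterval c a b = []) ↔ a = b := by
    constructor
    · rintro ⟨hab, hnil⟩
      have hlen := length_gapInterval c (a := a) (b := b) (by omega)
      rw [hnil, List.length_nil] at hlen
      exact le_antisymm hab (by omega)
    · rintro rfl
      exact ⟨le_rfl, gapInterval_self c a⟩
  rw [monomialMatrix, Matrix.one_apply, if_congr h rfl rfl]

theorem monomialMatrix_append (d e : List (Fin n)) :
    monomialMatrix c R (d ++ e) = monomialMatrix c R d * monomialMatrix c R e := by
  ext a b
  have hmid : ∀ m : Fin (c.length + 1), monomialMatrix c R d a m * monomialMatrix c R e m b =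
      if (a : ℕ) + d.length = m ∧ a ≤ b ∧ gapInterval c a b = d ++ e then 1 else 0 := by
    intro m
    rw [monomialMatrix, monomialMatrix, ite_zero_mul_ite_zero, one_mul]
    refine if_congr ⟨?_, ?_⟩ rfl rfl
    · rintro ⟨⟨ham, rfl⟩, hmb, rfl⟩
      refine ⟨?_, ham.trans hmb, (gapInterval_append c ham hmb).symm⟩
      rw [length_gapInterval c (by omega)]
      omega
    · rintro ⟨hm, hab, h⟩
      obtain ⟨hle, hd, he⟩ := (gapInterval_eq_append_iff hab (by omega)).1 h
      rw [hm] at hle hd he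
      exact ⟨⟨Fin.le_def.2 (by omega), hd⟩, hle, he⟩
  rw [Matrix.mul_apply, Finset.sum_congr rfl fun m _ => hmid m, monomialMatrix]
  split_ifs with h
  · have hle := ((gapInterval_eq_append_iff h.1 (by omega)).1 h.2).1
    rw [Finset.sum_eq_single ⟨a + d.length, by omega⟩ _ (by simp), if_pos ⟨rfl, h⟩]
    exact fun m _ hm => if_neg fun hm' => hm (Fin.ext hm'.1.symm)
  · exact (Finset.sum_eq_zero fun m _ => if_neg fun hm => h hm.2).symm

theorem prod_map_kappa (d : List (Fin n)) :
    (d.map (kappa c R)).prod = monomialMatrix c R d := by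
  induction d with
  | nil => rw [monomialMatrix_nil, List.map_nil, List.prod_nil]
  | cons k d ih => rw [List.map_cons, List.prod_cons, ih, ← monomialMatrix_append,
      List.singleton_append]

theorem supported_monomialMatrix (d : List (Fin n)) :
    Supported (fun x => x = d) (monomialMatrix c R d) :=
  fun _ _ hab => by_contra fun h => hab (if_neg h)

namespace Supported

variable {P Q W : List (Fin n) → Prop} {Y Z : GapMatrix c R}

theorem mono (h : ∀ x, P x → Q x) (hY : Supported P Y) : Supported Q Y :=
  fun a b hab => ⟨(hY a b hab).1, h _ (hY a b hab).2⟩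

theorem mul (h : ∀ x y, P x → Q y → W (x ++ y)) (hY : Supported P Y) (hZ : Supported Q Z) :
    Supported W (Y * Z) := by
  intro a b hab
  rw [Matrix.mul_apply] at hab
  obtain ⟨m, _, hm⟩ := Finset.exists_ne_zero_of_sum_ne_zero hab
  obtain ⟨ham, hP⟩ := hY a m (left_ne_zero_of_mul hm)
  obtain ⟨hmb, hQ⟩ := hZ m b (right_ne_zero_of_mul hm)
  exact ⟨ham.trans hmb, gapInterval_append c ham hmb ▸ h _ _ hP hQ⟩

theorem add (hY : Supported P Y) (hZ : Supported P Z) : Supported P (Y + Z) := by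
  intro a b hab
  by_cases h : Y a b = 0
  · exact hZ a b (by simpa [h] using hab)
  · exact hY a b h

theorem neg (hY : Supported P Y) : Supported P (-Y) :=
  fun a b hab => hY a b (by simpa using hab)

theorem sub (hY : Supported P Y) (hZ : Supported P Z) : Supported P (Y - Z) := by
  rw [sub_eq_add_neg]
  exact hY.add hZ.neg

theorem eq_zero (hY : Supported P Y) (h : ∀ d, d.Sublist c → ¬ P d) : Y = 0 := by
  ext a b
  by_contra hne
  exact h _ (gapInterval_sublist c _ _) (hY a b hne).2

end Supported

theorem supported_one {P : List (Fin n) → Prop} (h : P []) :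
    Supported P (1 : GapMatrix c R) :=
  monomialMatrix_nil (c := c) (R := R) ▸
    (supported_monomialMatrix []).mono (by rintro _ rfl; exact h)

theorem supported_zero (P : List (Fin n) → Prop) : Supported P (0 : GapMatrix c R) :=
  fun _ _ hab => absurd rfl hab

theorem degreeGE_kappa (k : Fin n) : DegreeGE 1 (kappa c R k) :=
  (supported_monomialMatrix [k]).mono (by rintro _ rfl; exact le_rfl)

theorem DegreeGE.mul {d e : ℕ} {Y Z : GapMatrix c R} (hY : DegreeGE d Y) (hZ : DegreeGE e Z) :
    DegreeGE (d + e) (Y * Z) :=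
  Supported.mul (fun x y hx hy => by rw [List.length_append]; exact Nat.add_le_add hx hy) hY hZ

theorem DegreeGE.eq_zero {d : ℕ} (hd : c.length < d) {Y : GapMatrix c R} (hY : DegreeGE d Y) :
    Y = 0 :=
  Supported.eq_zero hY fun _ hx h => (h.trans hx.length_le).not_gt hd

end GapMatrix

/-! ### Unitriangular matrices -/

/-- The group of the invertible matrices with ones on the diagonal and zeros below it, whose
inverses have the same form. -/
def unitriangular {n : ℕ} (c : List (Fin n)) (R : Type*) [CommRing R] :
    Subgroup (GapMatrix c R)ˣ where
  carrier := {x | DegreeGE 1 ((x : GapMatrix c R) - 1) ∧ DegreeGE 1 ((↑x⁻¹ : GapMatrix c R) - 1)}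
  one_mem' := by simp [supported_zero]
  inv_mem' := fun ⟨h, h'⟩ => ⟨h', by rwa [inv_inv]⟩
  mul_mem' := by
    have hmul : ∀ X Y : GapMatrix c R, DegreeGE 1 (X - 1) → DegreeGE 1 (Y - 1) →
        DegreeGE 1 (X * Y - 1) := by
      intro X Y hX hY
      have hXY : X * Y - 1 = (X - 1) * (Y - 1) + (X - 1) + (Y - 1) := by noncomm_ring
      rw [hXY]
      exact (((hX.mul hY).mono fun _ => Nat.le_of_succ_le).add hX).add hY
    rintro x y ⟨hx, hx'⟩ ⟨hy, hy'⟩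
    refine ⟨hmul _ _ hx hy, ?_⟩
    rw [mul_inv_rev]
    exact hmul _ _ hy' hx'

namespace unitriangular

variable {n : ℕ} {c : List (Fin n)} {R : Type*} [CommRing R]

/-- The matrix of an element of the unitriangular group. -/
def toMatrix : unitriangular c R →* GapMatrix c R :=
  (Units.coeHom _).comp (unitriangular c R).subtype

theorem toMatrix_injective :
    Function.Injective (toMatrix : unitriangular c R →* GapMatrix c R) :=
  Units.val_injective.comp Subtype.val_injective

theorem toMatrix_mul_inv (x : unitriangular c R) : toMatrix x * toMatrix x⁻¹ = 1 := by
  rw [← map_mul, mul_inv_cancel, map_one]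

theorem toMatrix_inv_mul (x : unitriangular c R) : toMatrix x⁻¹ * toMatrix x = 1 := by
  rw [← map_mul, inv_mul_cancel, map_one]

theorem degreeGE_toMatrix_sub_one (x : unitriangular c R) : DegreeGE 1 (toMatrix x - 1) :=
  x.2.1

theorem degreeGE_toMatrix (x : unitriangular c R) : DegreeGE 0 (toMatrix x) :=
  sub_add_cancel (toMatrix x) 1 ▸ ((degreeGE_toMatrix_sub_one x).mono fun _ _ => Nat.zero_le _).add
    (supported_one (Nat.zero_le _))

/-- The matrices that differ from `1` only on and above the `d`-th superdiagonal. -/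
def degreeSubgroup (c : List (Fin n)) (R : Type*) [CommRing R] (d : ℕ) :
    Subgroup (unitriangular c R) where
  carrier := {x | DegreeGE d (toMatrix x - 1)}
  one_mem' := by simp [supported_zero]
  mul_mem' := by
    intro x y (hx : DegreeGE d _) (hy : DegreeGE d _)
    have hxy : toMatrix (x * y) - 1 = (toMatrix x - 1) * toMatrix y + (toMatrix y - 1) := by
      rw [map_mul]
      noncomm_ring
    change DegreeGE d _
    rw [hxy]
    exact (hx.mul (degreeGE_toMatrix y)).add hy
  inv_mem' := by
    intro x (hx : DegreeGE d _)
    have hinv : toMatrix x⁻¹ - 1 = -((toMatrix x - 1) * toMatrix x⁻¹) := by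
      rw [sub_mul, toMatrix_mul_inv, one_mul, neg_sub]
    change DegreeGE d _
    rw [hinv]
    exact (hx.mul (degreeGE_toMatrix x⁻¹)).neg

theorem mem_degreeSubgroup {d : ℕ} {x : unitriangular c R} :
    x ∈ degreeSubgroup c R d ↔ DegreeGE d (toMatrix x - 1) := Iff.rfl

theorem degreeSubgroup_one : degreeSubgroup c R 1 = ⊤ :=
  eq_top_iff.2 fun x _ => degreeGE_toMatrix_sub_one x

theorem degreeSubgroup_eq_bot {d : ℕ} (hd : c.length < d) : degreeSubgroup c R d = ⊥ :=
  eq_bot_iff.2 fun _ hx => toMatrix_injective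
    ((sub_eq_zero.1 (DegreeGE.eq_zero hd hx)).trans (map_one _).symm)

open scoped commutatorElement in
theorem commutator_mem_degreeSubgroup {d : ℕ} {x : unitriangular c R}
    (hx : x ∈ degreeSubgroup c R d) (y : unitriangular c R) :
    ⁅x, y⁆ ∈ degreeSubgroup c R (d + 1) := by
  have hxy : toMatrix ⁅x, y⁆ - 1 = ((toMatrix x - 1) * (toMatrix y - 1) -
      (toMatrix y - 1) * (toMatrix x - 1)) * toMatrix (x⁻¹ * y⁻¹) := by
    have hcomm : (toMatrix x - 1) * (toMatrix y - 1) - (toMatrix y - 1) * (toMatrix x - 1) =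
        toMatrix (x * y) - toMatrix (y * x) := by
      rw [map_mul, map_mul]
      noncomm_ring
    rw [hcomm, sub_mul, ← map_mul, ← map_mul, commutatorElement_def,
      show y * x * (x⁻¹ * y⁻¹) = 1 by group, map_one, ← mul_assoc (x * y)]
  have hx : DegreeGE d (toMatrix x - 1) := hx
  have hy := degreeGE_toMatrix_sub_one y
  rw [mem_degreeSubgroup, hxy]
  have hsub := (hx.mul hy).sub (add_comm 1 d ▸ hy.mul hx)
  exact DegreeGE.mul (d := d + 1) hsub (degreeGE_toMatrix _)

instance : Group.IsNilpotent (unitriangular c R) := by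
  rw [Subgroup.nilpotent_iff_finite_descending_central_series]
  exact ⟨c.length, fun d => degreeSubgroup c R (d + 1),
    ⟨degreeSubgroup_one, fun _ _ hx y => commutator_mem_degreeSubgroup hx y⟩,
    degreeSubgroup_eq_bot (Nat.lt_succ_self _)⟩

theorem degreeSubgroup_length_le_center :
    degreeSubgroup c R c.length ≤ Subgroup.center (unitriangular c R) := by
  intro x hx
  rw [Subgroup.mem_center_iff]
  intro y
  have h := commutator_mem_degreeSubgroup hx y
  rw [degreeSubgroup_eq_bot (Nat.lt_succ_self _), Subgroup.mem_bot,
    commutatorElement_eq_one_iff_mul_comm] at h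
  exact h.symm

end unitriangular

section CommutesWithConjugates

variable {G : Type*} [Group G] {a : G}

/-- An element of a group commutes with all its conjugates. -/
def CommutesWithConjugates (a : G) : Prop := ∀ x : G, Commute (x⁻¹ * a * x) a

theorem CommutesWithConjugates.commute_conj_conj (ha : CommutesWithConjugates a) (x y : G) :
    Commute (x⁻¹ * a * x) (y⁻¹ * a * y) := by
  have h := (ha (x * y⁻¹)).map (MulAut.conj y⁻¹)
  simp only [MulAut.conj_apply, inv_inv] at h
  convert h using 1
  group

theorem CommutesWithConjugates.conj (ha : CommutesWithConjugates a) (y : G) :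
    CommutesWithConjugates (y⁻¹ * a * y) := by
  intro x
  convert ha.commute_conj_conj (y * x) y using 1
  group

end CommutesWithConjugates

/-! ### Meridians -/

section SubstGapMatrix

variable {n : ℕ} {c : List (Fin n)} {R : Type*} [CommRing R] {T : Fin n → GapMatrix c R}

theorem supported_prod_map (hT : ∀ k, Supported (fun y => [k].Sublist y) (T k))
    (d : List (Fin n)) : Supported (fun y => d.Sublist y) (d.map T).prod := by
  induction d with
  | nil => exact supported_one (List.nil_sublist _)
  | cons k d ih =>
    rw [List.map_cons, List.prod_cons]
    exact Supported.mul (fun x y hx hy => hx.append hy) (hT k) ih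

theorem prod_map_eq_zero (hT : ∀ k, Supported (fun y => [k].Sublist y) (T k))
    {d : List (Fin n)} (hd : ¬ d.Sublist c) : (d.map T).prod = 0 :=
  (supported_prod_map hT d).eq_zero fun _ he hde => hd (hde.trans he)

theorem finite_prod_map_ne_zero (hT : ∀ k, Supported (fun y => [k].Sublist y) (T k)) :
    {d : List (Fin n) | (d.map T).prod ≠ 0}.Finite :=
  c.sublists.toFinset.finite_toSet.subset fun d hd => by
    simpa using not_imp_comm.1 (prod_map_eq_zero hT) hd

theorem mul_eq_zero_of_supported (hc : c.Nodup) {k : Fin n} {Y Z : GapMatrix c R}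
    (hY : Supported (fun y => [k].Sublist y) Y) (hZ : Supported (fun y => [k].Sublist y) Z) :
    Y * Z = 0 :=
  (Supported.mul (W := fun y => [k, k].Sublist y) (fun _ _ hx hy => hx.append hy) hY hZ).eq_zero
    fun _ hd h => by simpa using (h.trans hd).nodup hc

theorem supported_kappa (k : Fin n) : Supported (fun y => [k].Sublist y) (kappa c R k) :=
  (supported_monomialMatrix [k]).mono (by rintro _ rfl; exact List.Sublist.refl _)

theorem kappa_eq_zero {k : Fin n} (hk : k ∉ c) : kappa c R k = 0 :=
  (supported_kappa k).eq_zero fun _ hd h => hk (List.singleton_sublist.1 (h.trans hd))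

theorem degreeGE_prod_map (hT : ∀ k, DegreeGE 1 (T k)) (d : List (Fin n)) :
    DegreeGE d.length (d.map T).prod := by
  induction d with
  | nil => exact supported_one (Nat.zero_le _)
  | cons k d ih =>
    rw [List.map_cons, List.prod_cons, List.length_cons, add_comm]
    exact DegreeGE.mul (hT k) ih

theorem degreeGE_prod_map_sub {T' : Fin n → GapMatrix c R} (hT : ∀ k, DegreeGE 1 (T k))
    (hT' : ∀ k, DegreeGE 1 (T' k)) (hsub : ∀ k, DegreeGE 2 (T k - T' k)) (d : List (Fin n)) :
    DegreeGE (d.length + 1) ((d.map T).prod - (d.map T').prod) := by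
  induction d with
  | nil => simp [supported_zero]
  | cons k d ih =>
    have hsplit : T k * (d.map T).prod - T' k * (d.map T').prod =
        T k * ((d.map T).prod - (d.map T').prod) + (T k - T' k) * (d.map T').prod := by
      noncomm_ring
    have h1 : DegreeGE (1 + (d.length + 1)) (T k * ((d.map T).prod - (d.map T').prod)) :=
      (hT k).mul ih
    have h2 : DegreeGE (2 + d.length) ((T k - T' k) * (d.map T').prod) :=
      (hsub k).mul (degreeGE_prod_map hT' d)
    rw [List.map_cons, List.prod_cons, List.map_cons, List.prod_cons, hsplit, List.length_cons]
    exact (h1.mono fun _ h => by omega).add (h2.mono fun _ h => by omega)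

theorem subst_kappa_apply (f : NCSeries n) {a b : Fin (c.length + 1)} (hab : a ≤ b) :
    NCSeries.subst (kappa c R) f a b = f (gapInterval c a b) := by
  have hentry : ∀ d, ((f d : GapMatrix c R) * (d.map (kappa c R)).prod) a b =
      if gapInterval c a b = d then (f d : R) else 0 := by
    intro d
    rw [← zsmul_eq_mul, Matrix.smul_apply, prod_map_kappa, monomialMatrix]
    simp [hab]
  have hfin :=
    NCSeries.finite_support_subst (finite_prod_map_ne_zero (T := kappa c R) supported_kappa) f
  refine ((Matrix.entryAddMonoidHom R a b).map_finsum hfin).trans ?_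
  simp only [Matrix.entryAddMonoidHom_apply, hentry]
  rw [finsum_eq_single _ (gapInterval c a b) fun d hd => if_neg hd.symm, if_pos rfl]

end SubstGapMatrix

namespace unitriangular

variable {n : ℕ} {c : List (Fin n)} (hc : c.Nodup) {R : Type*} [CommRing R]

/-- The unitriangular matrix `1 + κ_k`. -/
def meridian {n : ℕ} {c : List (Fin n)} (hc : c.Nodup) (R : Type*) [CommRing R] (k : Fin n) :
    unitriangular c R :=
  have hsq : kappa c R k * kappa c R k = 0 :=
    mul_eq_zero_of_supported hc (supported_kappa k) (supported_kappa k)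
  ⟨⟨1 + kappa c R k, 1 - kappa c R k, by noncomm_ring; simp [hsq], by noncomm_ring; simp [hsq]⟩,
    by simpa using degreeGE_kappa k,
    by simpa [sub_sub_cancel_left] using (degreeGE_kappa (c := c) (R := R) k).neg⟩

theorem toMatrix_meridian (k : Fin n) : toMatrix (meridian hc R k) = 1 + kappa c R k := rfl

theorem meridian_eq_one {k : Fin n} (hk : k ∉ c) : meridian hc R k = 1 :=
  toMatrix_injective (by rw [toMatrix_meridian, kappa_eq_zero hk, add_zero, map_one])

/-- The conjugate of `κ_k` by a unitriangular matrix `x`. -/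
def conjKappa (x : unitriangular c R) (k : Fin n) : GapMatrix c R :=
  toMatrix x⁻¹ * kappa c R k * toMatrix x

theorem toMatrix_conj_meridian (x : unitriangular c R) (k : Fin n) :
    toMatrix (x⁻¹ * meridian hc R k * x) = 1 + conjKappa x k := by
  rw [map_mul, map_mul, toMatrix_meridian, mul_add, mul_one, add_mul, toMatrix_inv_mul, conjKappa]

theorem supported_conjKappa (x : unitriangular c R) (k : Fin n) :
    Supported (fun y => [k].Sublist y) (conjKappa x k) :=
  Supported.mul (fun _ _ h _ => h.trans (List.sublist_append_left _ _))
    (Supported.mul (fun _ _ _ h => h.trans (List.sublist_append_right _ _))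
      (degreeGE_toMatrix x⁻¹) (supported_kappa k)) (degreeGE_toMatrix x)

theorem degreeGE_conjKappa (x : unitriangular c R) (k : Fin n) : DegreeGE 1 (conjKappa x k) :=
  (supported_conjKappa x k).mono fun _ h => h.length_le

theorem degreeGE_conjKappa_sub (x : unitriangular c R) (k : Fin n) :
    DegreeGE 2 (conjKappa x k - kappa c R k) := by
  have hsplit : conjKappa x k - kappa c R k =
      (toMatrix x⁻¹ - 1) * (kappa c R k * toMatrix x) + kappa c R k * (toMatrix x - 1) := by
    rw [conjKappa]
    noncomm_ring
  rw [hsplit]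
  exact ((degreeGE_toMatrix_sub_one x⁻¹).mul ((degreeGE_kappa k).mul (degreeGE_toMatrix x))).add
    ((degreeGE_kappa k).mul (degreeGE_toMatrix_sub_one x))

theorem commutesWithConjugates_meridian (k : Fin n) :
    CommutesWithConjugates (meridian hc R k) := by
  intro x
  have h1 := mul_eq_zero_of_supported hc (supported_conjKappa x k) (supported_kappa (R := R) k)
  have h2 := mul_eq_zero_of_supported hc (supported_kappa (R := R) k) (supported_conjKappa x k)
  refine toMatrix_injective ?_
  rw [map_mul toMatrix (x⁻¹ * meridian hc R k * x), map_mul toMatrix (meridian hc R k),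
    toMatrix_conj_meridian, toMatrix_meridian]
  exact (Commute.one_left _).add_left ((Commute.one_right _).add_right (h1.trans h2.symm))

theorem toMatrix_eval_meridian (w : SignedWord (Fin n)) :
    toMatrix (SignedWord.eval (meridian hc R) w) = NCSeries.subst (kappa c R) (NCSeries.phi w) :=
  NCSeries.map_eval_eq_subst (T := kappa c R) (finite_prod_map_ne_zero supported_kappa) toMatrix
    (meridian hc R) (toMatrix_meridian hc) w

theorem toMatrix_eval_meridian_apply (w : SignedWord (Fin n)) {a b : Fin (c.length + 1)}
    (hab : a ≤ b) :
    toMatrix (SignedWord.eval (meridian hc R) w) a b = NCSeries.phi w (gapInterval c a b) := by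
  rw [toMatrix_eval_meridian, subst_kappa_apply _ hab]

variable {hc} in
theorem eval_meridian_mem_degreeSubgroup {w : SignedWord (Fin n)}
    (hw : ∀ d : List (Fin n), d.Sublist c → d ≠ [] → d ≠ c → (NCSeries.phi w d : R) = 0) :
    SignedWord.eval (meridian hc R) w ∈ degreeSubgroup c R c.length := by
  intro a b hab
  obtain ⟨hle, hlen⟩ := degreeGE_toMatrix_sub_one _ a b hab
  refine ⟨hle, not_lt.1 fun hlt => hab ?_⟩
  have hne : a ≠ b := by
    rintro rfl
    rw [gapInterval_self] at hlen
    exact absurd hlen (by simp)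
  rw [Matrix.sub_apply, Matrix.one_apply_ne hne, sub_zero, toMatrix_eval_meridian_apply hc w hle]
  exact hw _ (gapInterval_sublist c _ _) (List.length_pos_iff.1 hlen)
    fun h => hlt.ne (congrArg List.length h)

/-- In the lowest nonvanishing degree, only the degree one parts of the meridians count. -/
theorem eval_conj_meridian {w : SignedWord (Fin n)}
    (hw : ∀ d : List (Fin n), d.Sublist c → d ≠ [] → d ≠ c → (NCSeries.phi w d : R) = 0)
    (x : Fin n → unitriangular c R) :
    SignedWord.eval (fun k => (x k)⁻¹ * meridian hc R k * x k) w =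
      SignedWord.eval (meridian hc R) w := by
  have hconj : ∀ k, Supported (fun y => [k].Sublist y) (conjKappa (x k) k) :=
    fun k => supported_conjKappa (x k) k
  refine toMatrix_injective (((NCSeries.map_eval_eq_subst (finite_prod_map_ne_zero hconj) toMatrix _
    (fun k => toMatrix_conj_meridian hc (x k) k) w).trans (finsum_congr fun d => ?_)).trans
    (toMatrix_eval_meridian hc w).symm)
  by_cases hd : d.Sublist c
  · rcases eq_or_ne d [] with rfl | hnil
    · rfl
    rcases eq_or_ne d c with rfl | hdc
    · rw [sub_eq_zero.1 (DegreeGE.eq_zero (Nat.lt_succ_self _) (degreeGE_prod_map_sub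
        (fun k => degreeGE_conjKappa (x k) k) degreeGE_kappa
        (fun k => degreeGE_conjKappa_sub (x k) k) d))]
    · rw [← zsmul_eq_mul, ← zsmul_eq_mul, ← Int.cast_smul_eq_zsmul R, ← Int.cast_smul_eq_zsmul R,
        hw d hd hnil hdc, zero_smul, zero_smul]
  · rw [prod_map_eq_zero hconj hd, prod_map_eq_zero supported_kappa hd]

end unitriangular

section ConjBy

variable {G : Type*} [Group G] {a : G}

theorem CommutesWithConjugates.commute_of_mem (ha : CommutesWithConjugates a) {z : G}
    (hz : z ∈ Subgroup.normalClosure {a}) : Commute z a := by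
  have hle : Subgroup.normalClosure {a} ≤ Subgroup.centralizer {a} := by
    rw [Subgroup.normalClosure, Subgroup.closure_le]
    intro y hy
    obtain ⟨b, rfl, hby⟩ := Group.mem_conjugatesOfSet_iff.1 hy
    obtain ⟨x, rfl⟩ := isConj_iff.1 hby
    rw [SetLike.mem_coe, Subgroup.mem_centralizer_singleton_iff]
    simpa using (ha x⁻¹).eq
  exact Subgroup.mem_centralizer_singleton_iff.1 (hle hz)

/-- The conjugate `x⁻¹ a x`, as a function of the class of `x` modulo the normal closure of `a`;
it does not depend on the representative if `a` commutes with its conjugates. -/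
noncomputable def conjBy (a : G) (q : G ⧸ Subgroup.normalClosure {a}) : G :=
  q.out⁻¹ * a * q.out

theorem CommutesWithConjugates.conjBy_mk (ha : CommutesWithConjugates a) (x : G) :
    conjBy a (x : G ⧸ Subgroup.normalClosure {a}) = x⁻¹ * a * x := by
  obtain ⟨z, hz⟩ := QuotientGroup.mk_out_eq_mul (Subgroup.normalClosure {a}) x
  have hmem : x * z * x⁻¹ ∈ Subgroup.normalClosure {a} :=
    Subgroup.Normal.conj_mem inferInstance _ z.2 x
  rw [conjBy, hz]
  calc (x * (z : G))⁻¹ * a * (x * z)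
      = x⁻¹ * (x * z * x⁻¹)⁻¹ * (a * (x * z * x⁻¹)) * x := by group
    _ = x⁻¹ * a * x := by rw [← (ha.commute_of_mem hmem).eq]; group

theorem CommutesWithConjugates.conjBy_mul (ha : CommutesWithConjugates a)
    (q : G ⧸ Subgroup.normalClosure {a}) (y : G) :
    conjBy a (q * y) = y⁻¹ * conjBy a q * y := by
  obtain ⟨x, rfl⟩ := QuotientGroup.mk_surjective q
  rw [← QuotientGroup.mk_mul, ha.conjBy_mk, ha.conjBy_mk]
  group

theorem CommutesWithConjugates.commute_conjBy (ha : CommutesWithConjugates a)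
    (q r : G ⧸ Subgroup.normalClosure {a}) : Commute (conjBy a q) (conjBy a r) :=
  ha.commute_conj_conj _ _

theorem mk_conjBy (q : G ⧸ Subgroup.normalClosure {a}) :
    ((conjBy a q : G) : G ⧸ Subgroup.normalClosure {a}) = 1 := by
  rw [QuotientGroup.eq_one_iff, conjBy]
  simpa using Subgroup.Normal.conj_mem (H := Subgroup.normalClosure {a}) inferInstance a
    (Subgroup.subset_normalClosure rfl) q.out⁻¹

end ConjBy

/-! ### Conditions along a word -/

/-- A condition on the letters of a word that depends on the product of the values of the letters
on their left. -/
structure ScanRule (Q L : Type*) where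
  /-- the condition on a letter, given the product to its left -/
  cond : Q → L → Prop
  /-- the value of a letter -/
  val : L → Q

namespace ScanRule

variable {Q L L' : Type*} [Group Q]

/-- All the letters of a word to be read after a word of value `q` satisfy their conditions. -/
def Holds (r : ScanRule Q L) : Q → List L → Prop
  | _, [] => True
  | q, A :: l => r.cond q A ∧ r.Holds (q * r.val A) l

/-- The product of the values of the letters of a word. -/
def prod (r : ScanRule Q L) (l : List L) : Q := (l.map r.val).prod

/-- The word `l'` for the rule `r'` can replace the word `l` for the rule `r`. -/
def Transfers (r : ScanRule Q L) (r' : ScanRule Q L') (l : List L) (l' : List L') : Prop :=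
  ∀ q, r.Holds q l → r'.Holds q l' ∧ r'.prod l' = r.prod l

variable {r : ScanRule Q L} {r' : ScanRule Q L'}

theorem prod_append (l₁ l₂ : List L) : r.prod (l₁ ++ l₂) = r.prod l₁ * r.prod l₂ := by
  simp [prod]

theorem holds_append {q : Q} {l₁ l₂ : List L} :
    r.Holds q (l₁ ++ l₂) ↔ r.Holds q l₁ ∧ r.Holds (q * r.prod l₁) l₂ := by
  induction l₁ generalizing q with
  | nil => simp [Holds, prod]
  | cons A l ih => simp [Holds, prod, ih, and_assoc, mul_assoc]

theorem holds_iff {q : Q} {l : List L} :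
    r.Holds q l ↔ ∀ x A y, l = x ++ A :: y → r.cond (q * r.prod x) A := by
  constructor
  · rintro h x A y rfl
    exact (holds_append.1 h).2.1
  · intro h
    induction l generalizing q with
    | nil => trivial
    | cons B l ih =>
      refine ⟨by simpa [prod] using h [] B l rfl, ih fun x A y hl => ?_⟩
      simpa [prod, mul_assoc] using h (B :: x) A y (by rw [hl, List.cons_append])

theorem Transfers.trans {L'' : Type*} {r'' : ScanRule Q L''} {l : List L} {l' : List L'}
    {l'' : List L''} (h : r.Transfers r' l l') (h' : r'.Transfers r'' l' l'') :
    r.Transfers r'' l l'' := by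
  intro q hq
  obtain ⟨hq', hprod⟩ := h q hq
  obtain ⟨hq'', hprod'⟩ := h' q hq'
  exact ⟨hq'', hprod'.trans hprod⟩

theorem Transfers.append {l₁ l₂ : List L} {l₁' l₂' : List L'} (h₁ : r.Transfers r' l₁ l₁')
    (h₂ : r.Transfers r' l₂ l₂') : r.Transfers r' (l₁ ++ l₂) (l₁' ++ l₂') := by
  intro q hq
  obtain ⟨hq₁, hq₂⟩ := holds_append.1 hq
  obtain ⟨hl₁, hprod₁⟩ := h₁ q hq₁
  obtain ⟨hl₂, hprod₂⟩ := h₂ _ hq₂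
  exact ⟨holds_append.2 ⟨hl₁, hprod₁ ▸ hl₂⟩, by rw [prod_append, prod_append, hprod₁, hprod₂]⟩

theorem Transfers.of_map {f : L' → L} {l : List L'}
    (hcond : ∀ A ∈ l, ∀ q, r.cond q (f A) → r'.cond q A)
    (hval : ∀ A ∈ l, r'.val A = r.val (f A)) : r.Transfers r' (l.map f) l := by
  induction l with
  | nil => exact fun _ _ => ⟨trivial, rfl⟩
  | cons A l ih =>
    refine Transfers.append (l₁ := [f A]) (l₁' := [A]) (fun q hq => ?_)
      (ih (fun B hB => hcond B (List.mem_cons_of_mem _ hB))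
        fun B hB => hval B (List.mem_cons_of_mem _ hB))
    exact ⟨⟨hcond A List.mem_cons_self q hq.1, trivial⟩, by simp [prod, hval A List.mem_cons_self]⟩

end ScanRule

/-! ### Letters and components -/

namespace AlphaV

/-- The sign of the first occurrence of a letter, if the occurrences are in different components. -/
def fstSign : AlphaV → SignType
  | .bp => 1
  | .am => -1
  | _ => 0

/-- The sign of the second occurrence of a letter, if the occurrences are in different
components. -/
def sndSign : AlphaV → SignType
  | .ap => 1
  | .bm => -1
  | _ => 0

theorem fstSign_eq_zero_iff {a : AlphaV} : a.fstSign = 0 ↔ a.sndSign ≠ 0 := by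
  cases a <;> decide

end AlphaV

theorem isGauss_iff {L : Type u} [DecidableEq L] {n : ℕ} {w : Fin n → List L} :
    IsGauss w ↔ ∀ A, ∑ k, (w k).count A = 2 := by
  simp [IsGauss, List.count_flatten, List.map_ofFn, List.sum_ofFn]

namespace Nanophrase

variable {n : ℕ} (p : Nanophrase.{u} AlphaV n) {i j k : Fin n} {A : p.Letter}

theorem sum_count_le_two (s : Finset (Fin n)) (A : p.Letter) :
    ∑ k ∈ s, (p.word k).count A ≤ 2 :=
  (Finset.sum_le_sum_of_subset (Finset.subset_univ s)).trans (isGauss_iff.1 p.gauss A).le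

variable {p}

theorem eq_or_eq_of_mem (hi : A ∈ p.word i) (hj : A ∈ p.word j) (hij : i ≠ j)
    (hk : A ∈ p.word k) : k = i ∨ k = j := by
  by_contra! h
  have hsum := p.sum_count_le_two {i, j, k} A
  rw [Finset.sum_insert (by simp [hij, h.1.symm]), Finset.sum_pair h.2.symm] at hsum
  have := List.count_pos_iff.2 hi
  have := List.count_pos_iff.2 hj
  have := List.count_pos_iff.2 hk
  omega

theorem eq_of_two_le_count (hi : 2 ≤ (p.word i).count A) (hj : A ∈ p.word j) : j = i := by
  by_contra h
  have hsum := p.sum_count_le_two {i, j} A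
  rw [Finset.sum_pair (Ne.symm h)] at hsum
  have := List.count_pos_iff.2 hj
  omega

theorem sign_fst (hj : A ∈ p.word j) (hij : i < j) : p.sign i A = (p.proj A).fstSign := by
  rw [sign, if_pos ⟨j, hij, hj⟩]
  cases p.proj A <;> rfl

theorem sign_snd (hi : A ∈ p.word i) (hj : A ∈ p.word j) (hij : i < j) :
    p.sign j A = (p.proj A).sndSign := by
  rw [sign, if_neg, if_pos ⟨i, hij, hi⟩]
  · cases p.proj A <;> rfl
  · rintro ⟨k, hk, hAk⟩
    rcases eq_or_eq_of_mem hi hj hij.ne hAk with rfl | rfl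
    · exact lt_asymm hij hk
    · exact lt_irrefl _ hk

theorem sign_eq_zero (h : ∀ j, A ∈ p.word j → j = k) : p.sign k A = 0 := by
  rw [sign, if_neg, if_neg]
  · rintro ⟨j, hj, hA⟩
    exact hj.ne (h j hA)
  · rintro ⟨j, hj, hA⟩
    exact hj.ne' (h j hA)

theorem exists_mem_ne_of_sign_ne_zero (h : p.sign k A ≠ 0) : ∃ j ≠ k, A ∈ p.word j := by
  by_contra! h'
  exact h (sign_eq_zero fun j hj => by_contra fun hne => h' j hne hj)

theorem eta_of_lt (hi : A ∈ p.word i) (hj : A ∈ p.word j) (hij : i < j) :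
    p.eta A = if (p.proj A).fstSign = 0 then i else j := by
  have hs : p.support A = {i, j} := by
    ext k
    simp only [support, Finset.mem_filter, Finset.mem_univ, true_and, Finset.mem_insert,
      Finset.mem_singleton]
    exact ⟨eq_or_eq_of_mem hi hj hij.ne, by rintro (rfl | rfl) <;> assumption⟩
  have hmax : (p.support A).max' (p.support_nonempty A) = j := by
    simp only [hs, Finset.max'_pair, max_eq_right hij.le]
  have hmin : (p.support A).min' (p.support_nonempty A) = i := by
    simp only [hs, Finset.min'_pair, min_eq_left hij.le]
  rw [eta, hmax, hmin]
  cases p.proj A <;> simp [AlphaV.fstSign]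

variable (p) in
/-- The letter `A` occurs in the component `k` with sign zero, and in another component. -/
def IsOver (k : Fin n) (A : p.Letter) : Prop :=
  A ∈ p.word k ∧ p.sign k A = 0 ∧ ∃ j ≠ k, A ∈ p.word j

variable (p) in
/-- The occurrences of the letter `A` are in the components `k` and `l`; if these are different,
the signs are `0` in `k` and `ε` in `l`. -/
structure IsCrossing (k l : Fin n) (ε : SignType) (A : p.Letter) : Prop where
  mem_iff : ∀ j, A ∈ p.word j ↔ j = k ∨ j = l
  sign_over : p.sign k A = 0
  sign_under : p.sign l A = if k = l then 0 else ε
  sign_ne_zero : ε ≠ 0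

theorem IsCrossing.isOver_iff {l : Fin n} {ε : SignType} (h : p.IsCrossing k l ε A) :
    p.IsOver j A ↔ k ≠ l ∧ j = k := by
  constructor
  · rintro ⟨hj, hs, i, hij, hi⟩
    rw [h.mem_iff] at hi hj
    have hkl : k ≠ l := by
      rintro rfl
      exact hij ((or_self_iff.1 hi).trans (or_self_iff.1 hj).symm)
    refine ⟨hkl, hj.resolve_right ?_⟩
    rintro rfl
    rw [h.sign_under, if_neg hkl] at hs
    exact h.sign_ne_zero hs
  · rintro ⟨hkl, rfl⟩
    exact ⟨(h.mem_iff _).2 (.inl rfl), h.sign_over, l, hkl.symm, (h.mem_iff _).2 (.inr rfl)⟩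

theorem isCrossing_of_fstSign_eq_zero (hA : ∀ k, A ∈ p.word k ↔ k = i ∨ k = j) (hij : i ≤ j)
    (h : (p.proj A).fstSign = 0) : p.IsCrossing i j (p.proj A).sndSign A := by
  have hne := AlphaV.fstSign_eq_zero_iff.1 h
  rcases hij.eq_or_lt with rfl | hlt
  · have hs : p.sign i A = 0 := sign_eq_zero fun k hk => or_self_iff.1 ((hA k).1 hk)
    exact ⟨hA, hs, by rw [hs, if_pos rfl], hne⟩
  · have hi := (hA i).2 (.inl rfl)
    have hj := (hA j).2 (.inr rfl)
    exact ⟨hA, (sign_fst hj hlt).trans h, by rw [sign_snd hi hj hlt, if_neg hlt.ne], hne⟩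

theorem isCrossing_of_sndSign_eq_zero (hA : ∀ k, A ∈ p.word k ↔ k = i ∨ k = j) (hij : i ≤ j)
    (h : (p.proj A).sndSign = 0) : p.IsCrossing j i (p.proj A).fstSign A := by
  have hne : (p.proj A).fstSign ≠ 0 := fun h0 => AlphaV.fstSign_eq_zero_iff.1 h0 h
  have hA' : ∀ k, A ∈ p.word k ↔ k = j ∨ k = i := fun k => (hA k).trans or_comm
  rcases hij.eq_or_lt with rfl | hlt
  · have hs : p.sign i A = 0 := sign_eq_zero fun k hk => or_self_iff.1 ((hA k).1 hk)
    exact ⟨hA', hs, by rw [hs, if_pos rfl], hne⟩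
  · have hi := (hA i).2 (.inl rfl)
    have hj := (hA j).2 (.inr rfl)
    exact ⟨hA', (sign_snd hi hj hlt).trans h, by rw [sign_fst hj hlt, if_neg hlt.ne'], hne⟩

theorem exists_isOver (hi : A ∈ p.word i) (hj : A ∈ p.word j) (hij : i ≠ j) :
    ∃ k, p.IsOver k A := by
  wlog hlt : i < j generalizing i j
  · exact this hj hi hij.symm (lt_of_le_of_ne (not_lt.1 hlt) hij.symm)
  by_cases h : (p.proj A).fstSign = 0
  · exact ⟨i, hi, (sign_fst hj hlt).trans h, j, hlt.ne', hj⟩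
  · exact ⟨j, hj, (sign_snd hi hj hlt).trans (not_not.1 (mt AlphaV.fstSign_eq_zero_iff.2 h)),
      i, hlt.ne, hi⟩

theorem exists_isOver_of_sign_ne_zero (hA : A ∈ p.word k) (h : p.sign k A ≠ 0) :
    ∃ j, p.IsOver j A :=
  let ⟨_, hj, hAj⟩ := exists_mem_ne_of_sign_ne_zero h
  exists_isOver hAj hA hj

theorem IsOver.eta_eq (h : p.IsOver k A) : p.eta A = k := by
  obtain ⟨hk, hs, j, hjk, hj⟩ := h
  rcases hjk.lt_or_gt with hlt | hlt
  · rw [sign_snd hj hk hlt] at hs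
    rw [eta_of_lt hj hk hlt, if_neg fun h => AlphaV.fstSign_eq_zero_iff.1 h hs]
  · rw [sign_fst hj hlt] at hs
    rw [eta_of_lt hk hj hlt, if_pos hs]

theorem IsOver.notMem_prefix (h : p.IsOver k A) {x y : List p.Letter}
    (hk : p.word k = x ++ A :: y) : A ∉ x := by
  obtain ⟨_, _, j, hjk, hj⟩ := h
  intro hx
  refine hjk (eq_of_two_le_count ?_ hj)
  rw [hk, List.count_append, List.count_cons_self]
  have := List.count_pos_iff.2 hx
  omega

end Nanophrase

/-! ### Colorings -/

open scoped commutatorElement in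
theorem conj_congr_lowerCentralSeries {G : Type*} [Group G] {d : ℕ} {a x y : G}
    (h : x⁻¹ * y ∈ (⊤ : Subgroup G).lowerCentralSeries d) :
    (x⁻¹ * a * x)⁻¹ * (y⁻¹ * a * y) ∈ (⊤ : Subgroup G).lowerCentralSeries (d + 1) := by
  have hcomm : ⁅(x⁻¹ * y)⁻¹, (x⁻¹ * a * x)⁻¹⁆ ∈ (⊤ : Subgroup G).lowerCentralSeries (d + 1) :=
    Subgroup.commutator_mem_commutator (inv_mem h) (Subgroup.mem_top _)
  convert inv_mem hcomm using 1
  rw [commutatorElement_def]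
  group

namespace Nanophrase

variable {n : ℕ} (p : Nanophrase.{u} AlphaV n) {G : Type*} [Group G] (g : Fin n → G)
  (m : p.Letter → G) {k : Fin n} {A : p.Letter}

/-- The contribution of an occurrence of a letter in the component `k`. -/
def val (k : Fin n) (A : p.Letter) : G := m A ^ ((p.sign k A : SignType) : ℤ)

/-- Along the component `k`, a letter which passes over has as value the conjugate of `g k` by the
product of the contributions to its left. -/
noncomputable def rule (k : Fin n) :
    ScanRule (G ⧸ Subgroup.normalClosure {g k}) p.Letter where
  cond q A := p.IsOver k A → m A = conjBy (g k) q
  val A := (p.val m k A : G)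

/-- A letter takes as value the conjugate of the value of the component of its occurrence of sign
zero, by the product along this component up to that occurrence. -/
def IsColoring : Prop := ∀ k, (p.rule g m k).Holds 1 (p.word k)

/-- The product of the contributions of the letters of the component `k`. -/
def longitude (k : Fin n) : G := ((p.word k).map (p.val m k)).prod

/-- The equations of a coloring in the form of a fixed point, matching the recursion of `rho`. -/
def conjBefore (A : p.Letter) : G :=
  (SignedWord.eval m (p.before A))⁻¹ * g (p.eta A) * SignedWord.eval m (p.before A)

/-- The value of a letter given by the `q`-th approximation. -/
def approxValue (q : ℕ) (A : p.Letter) : G := SignedWord.eval g (p.etaWord (p.rho q [(A, true)]))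

variable {p g m}

theorem rule_prod (k : Fin n) (w : List p.Letter) :
    (p.rule g m k).prod w = ((w.map (p.val m k)).prod : G) := by
  rw [← QuotientGroup.mk'_apply, map_list_prod, List.map_map]
  rfl

theorem val_eq_one (h : p.sign k A = 0) : p.val m k A = 1 := by
  simp [val, h]

theorem eval_signedWord (k : Fin n) (w : List p.Letter) :
    SignedWord.eval m (p.signedWord k w) = (w.map (p.val m k)).prod := by
  induction w with
  | nil => rfl
  | cons A w ih =>
    have hcons : p.signedWord k (A :: w) = p.signedWord k [A] ++ p.signedWord k w := by
      simp [signedWord]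
    have hone : SignedWord.eval m (p.signedWord k [A]) = p.val m k A := by
      simp only [signedWord, List.flatMap_cons, List.flatMap_nil, List.append_nil, val]
      rcases p.sign k A with _ | _ | _ <;> simp [SignedWord.eval]
    rw [hcons, SignedWord.eval_append, ih, hone, List.map_cons, List.prod_cons]

theorem exists_isOver_of_mem_signedWord {w : List p.Letter} (hw : w ⊆ p.word k)
    {a : p.Letter × Bool} (ha : a ∈ p.signedWord k w) : ∃ j, p.IsOver j a.1 := by
  obtain ⟨A, hA, haA⟩ := List.mem_flatMap.1 ha
  have hs : p.sign k A ≠ 0 := fun h0 => by simp [h0] at haA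
  have hfst : a.1 = A := by
    rcases h : p.sign k A with _ | _ | _ <;> simp_all
  exact hfst ▸ exists_isOver_of_sign_ne_zero (hw hA) hs

theorem exists_isOver_of_mem_before {a : p.Letter × Bool} (ha : a ∈ p.before A) :
    ∃ j, p.IsOver j a.1 :=
  exists_isOver_of_mem_signedWord (List.takeWhile_subset _) ha

theorem IsOver.before_eq (h : p.IsOver k A) {x y : List p.Letter} (hk : p.word k = x ++ A :: y) :
    p.before A = p.signedWord k x := by
  rw [before, h.eta_eq, hk, List.takeWhile_append_of_pos]
  · simp
  · intro B hB
    simp only [ne_eq, decide_eq_true_eq]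
    rintro rfl
    exact h.notMem_prefix hk hB

theorem IsOver.conjBefore_eq (h : p.IsOver k A) {x y : List p.Letter}
    (hk : p.word k = x ++ A :: y) :
    p.conjBefore g m A =
      ((x.map (p.val m k)).prod)⁻¹ * g k * (x.map (p.val m k)).prod := by
  rw [conjBefore, h.eta_eq, h.before_eq hk, eval_signedWord]

theorem isColoring_iff (hg : ∀ k, CommutesWithConjugates (g k)) :
    p.IsColoring g m ↔ ∀ k A, p.IsOver k A → m A = p.conjBefore g m A := by
  have hcond : ∀ k x A y, p.word k = x ++ A :: y →
      ((p.rule g m k).cond (1 * (p.rule g m k).prod x) A ↔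
        (p.IsOver k A → m A = p.conjBefore g m A)) := by
    refine fun k x A y hk => imp_congr_right fun h => ?_
    rw [one_mul, rule_prod, (hg k).conjBy_mk, h.conjBefore_eq hk]
  refine forall_congr' fun k => ?_
  rw [ScanRule.holds_iff]
  constructor
  · intro h A hA
    obtain ⟨x, y, hxy⟩ := List.append_of_mem hA.1
    exact (hcond k x A y hxy).1 (h x A y hxy) hA
  · exact fun h x A y hxy => (hcond k x A y hxy).2 (h A)

/-- The recursion defining `rho` forgets its initial value, as conjugates of `a` by elements that
agree modulo `γ_d` agree modulo `γ_{d+1}`. -/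
theorem eventually_eq_of_conjBefore [Group.IsNilpotent G] {s s' : ℕ → p.Letter → G} {q₀ : ℕ}
    (hs : ∀ q ≥ q₀, ∀ k A, p.IsOver k A → s (q + 1) A = p.conjBefore g (s q) A)
    (hs' : ∀ q ≥ q₀, ∀ k A, p.IsOver k A → s' (q + 1) A = p.conjBefore g (s' q) A) :
    ∃ d, ∀ q ≥ d, ∀ k A, p.IsOver k A → s q A = s' q A := by
  have hcongr : ∀ d, ∀ q ≥ d + q₀, ∀ k A, p.IsOver k A →
      (s q A)⁻¹ * s' q A ∈ (⊤ : Subgroup G).lowerCentralSeries d := by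
    intro d
    induction d with
    | zero => simp
    | succ d ih =>
      intro q hq k A hA
      obtain ⟨q, rfl⟩ := Nat.exists_eq_add_of_le' (show 1 ≤ q by omega)
      rw [hs q (by omega) k A hA, hs' q (by omega) k A hA]
      refine conj_congr_lowerCentralSeries ?_
      rw [← QuotientGroup.eq, ← QuotientGroup.mk'_apply, ← QuotientGroup.mk'_apply,
        SignedWord.map_eval, SignedWord.map_eval]
      refine SignedWord.eval_congr fun a ha => ?_
      obtain ⟨j, hj⟩ := exists_isOver_of_mem_before ha
      rw [QuotientGroup.mk'_apply, QuotientGroup.mk'_apply, QuotientGroup.eq]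
      exact ih q (by omega) j a.1 hj
  obtain ⟨d, hd⟩ := Subgroup.nilpotent_iff_lowerCentralSeries.1 ‹Group.IsNilpotent G›
  refine ⟨d + q₀, fun q hq k A hA => ?_⟩
  have hmem := hcongr d q hq k A hA
  rwa [hd, Subgroup.mem_bot, inv_mul_eq_one] at hmem

theorem eval_rho (q : ℕ) (w : SignedWord p.Letter) :
    SignedWord.eval g (p.etaWord (p.rho q w)) = SignedWord.eval (p.approxValue g q) w := by
  induction w with
  | nil => simp [rho_nil, etaWord]
  | cons a w ih =>
    rw [rho_cons, etaWord_append, SignedWord.eval_append, ih, SignedWord.eval_cons]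
    congr 1
    obtain ⟨A, b⟩ := a
    cases b
    · have hinv : ([(A, false)] : SignedWord p.Letter) = SignedWord.inv [(A, true)] := rfl
      rw [hinv, rho_inv, etaWord_inv, SignedWord.eval_inv]
      rfl
    · rfl

theorem approxValue_succ {q : ℕ} (hq : 2 ≤ q) (A : p.Letter) :
    p.approxValue g (q + 1) A = p.conjBefore g (p.approxValue g q) A := by
  obtain ⟨q, rfl⟩ := Nat.exists_eq_add_of_le' hq
  have hrho : p.rho (q + 2 + 1) [(A, true)] =
      p.rho (q + 2) (p.before A).inv ++ ([(A, true)] ++ p.rho (q + 2) (p.before A)) := by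
    simp [rho]
  have hone : SignedWord.eval g (p.etaWord [(A, true)]) = g (p.eta A) := by
    simp [etaWord, SignedWord.eval]
  rw [approxValue, hrho, etaWord_append, etaWord_append, SignedWord.eval_append,
    SignedWord.eval_append, eval_rho, eval_rho, SignedWord.eval_inv, hone, conjBefore, mul_assoc]

variable [Group.IsNilpotent G] (hg : ∀ k, CommutesWithConjugates (g k))

include hg

variable (p) in
theorem exists_isColoring : ∃ m, p.IsColoring g m := by
  obtain ⟨d, hd⟩ := eventually_eq_of_conjBefore (p := p) (g := g) (q₀ := 2)
    (s := p.approxValue g) (s' := fun q => p.approxValue g (q + 1))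
    (fun q hq _ A _ => approxValue_succ hq A) (fun q hq _ A _ => approxValue_succ (by omega) A)
  refine ⟨p.approxValue g (d + 2), (isColoring_iff hg).2 fun k A hA => ?_⟩
  rw [hd (d + 2) (by omega) k A hA, approxValue_succ (by omega)]

theorem IsColoring.eventually_eval_rho_eq (hm : p.IsColoring g m) :
    ∃ d, ∀ q ≥ d, ∀ k,
      SignedWord.eval g (p.etaWord (p.rho q (p.signedWord k (p.word k)))) = p.longitude m k := by
  obtain ⟨d, hd⟩ := eventually_eq_of_conjBefore (q₀ := 2)
    (s := p.approxValue g) (s' := fun _ => m)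
    (fun q hq _ A _ => approxValue_succ hq A) (fun _ _ => (isColoring_iff hg).1 hm)
  refine ⟨d, fun q hq k => ?_⟩
  rw [eval_rho, longitude, ← eval_signedWord]
  refine SignedWord.eval_congr fun a ha => ?_
  obtain ⟨j, hj⟩ := exists_isOver_of_mem_signedWord (List.Subset.refl _) ha
  exact hd q hq j a.1 hj

end Nanophrase

/-! ### Phrases written in one line -/

namespace Token

variable {L L' : Type u}

/-- The number of bars. -/
def bars : List (Token L) → ℕ
  | [] => 0
  | letter _ :: s => bars s
  | bar :: s => bars s + 1

/-- The letters of a sequence of symbols. -/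
def letters : List (Token L) → List L
  | [] => []
  | letter A :: s => A :: letters s
  | bar :: s => letters s

/-- The letters in the component `k`, for a sequence of symbols that starts in the component `b`. -/
def component : ℕ → List (Token L) → ℕ → List L
  | _, [], _ => []
  | b, letter A :: s, k => (if b = k then [A] else []) ++ component b s k
  | b, bar :: s, k => component (b + 1) s k

theorem map_id : (Token.map id : Token L → Token L) = id := by
  funext a
  cases a <;> rfl

theorem bars_append (s t : List (Token L)) : bars (s ++ t) = bars s + bars t := by
  induction s with
  | nil => simp [bars]
  | cons a s ih => cases a <;> simp [bars, ih]; omega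

theorem letters_append (s t : List (Token L)) : letters (s ++ t) = letters s ++ letters t := by
  induction s with
  | nil => simp [letters]
  | cons a s ih => cases a <;> simp [letters, ih]

theorem component_append (b k : ℕ) (s t : List (Token L)) :
    component b (s ++ t) k = component b s k ++ component (b + bars s) t k := by
  induction s generalizing b with
  | nil => simp [component, bars]
  | cons a s ih => cases a <;> simp [component, bars, ih, add_assoc, add_comm]

theorem bars_map (f : L → L') (s : List (Token L)) : bars (s.map (Token.map f)) = bars s := by
  induction s with
  | nil => rfl
  | cons a s ih => cases a <;> simp [bars, Token.map, ih]

theorem component_map (f : L → L') (b k : ℕ) (s : List (Token L)) :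
    component b (s.map (Token.map f)) k = (component b s k).map f := by
  induction s generalizing b with
  | nil => simp [component]
  | cons a s ih =>
    cases a
    · simp only [List.map_cons, Token.map, component, ih, List.map_append]
      split_ifs <;> simp
    · simp [Token.map, component, ih]

theorem mem_letters_of_mem_component {b k : ℕ} {s : List (Token L)} {A : L}
    (h : A ∈ component b s k) : A ∈ letters s := by
  induction s generalizing b with
  | nil => simp [component] at h
  | cons a s ih =>
    cases a
    · rcases List.mem_append.1 h with h | h
      · split_ifs at h <;> simp_all [letters]
      · exact List.mem_cons_of_mem _ (ih h)
    · exact ih h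

theorem bars_map_letter (l : List L) : bars (l.map letter) = 0 := by
  induction l with
  | nil => rfl
  | cons _ _ ih => exact ih

theorem letters_map_letter (l : List L) : letters (l.map letter) = l := by
  induction l with
  | nil => rfl
  | cons A l ih => exact congrArg (A :: ·) ih

theorem component_map_letter (b k : ℕ) (l : List L) :
    component b (l.map letter) k = if b = k then l else [] := by
  induction l with
  | nil => simp [component]
  | cons A l ih =>
    simp only [List.map_cons, component, ih]
    split_ifs <;> rfl

theorem intercalate_cons_cons (l l' : List L) (ls : List (List L)) :
    [bar].intercalate ((l :: l' :: ls).map (List.map letter)) =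
      l.map letter ++ ([bar] ++ [bar].intercalate ((l' :: ls).map (List.map letter))) := by
  simp [List.intercalate]

theorem component_intercalate (ls : List (List L)) (b k : ℕ) :
    component b ([bar].intercalate (ls.map (List.map letter))) k =
      if b ≤ k then ls.getD (k - b) [] else [] := by
  induction ls generalizing b with
  | nil => simp [component, List.intercalate]
  | cons l ls ih =>
    have hcons : component b ([bar].intercalate ((l :: ls).map (List.map letter))) k =
        (if b = k then l else []) ++ if b + 1 ≤ k then ls.getD (k - (b + 1)) [] else [] := by
      cases ls with
      | nil => simp [List.intercalate, component_map_letter]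
      | cons l' ls =>
        rw [intercalate_cons_cons, component_append, component_append, ih, component_map_letter,
          bars_map_letter]
        rfl
    rw [hcons]
    rcases lt_trichotomy b k with h | rfl | h
    · obtain ⟨d, rfl⟩ := Nat.exists_eq_add_of_lt h
      have hsub : b + d + 1 - b = d + 1 ∧ b + d + 1 - (b + 1) = d := by omega
      rw [hsub.1, hsub.2, if_neg h.ne, if_pos (Nat.succ_le_of_lt h), if_pos h.le,
        List.getD_cons_succ, List.nil_append]
    · simp
    · rw [if_neg h.ne', if_neg (by omega), if_neg (by omega), List.nil_append]

theorem letters_intercalate (ls : List (List L)) :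
    letters ([bar].intercalate (ls.map (List.map letter))) = ls.flatten := by
  induction ls with
  | nil => rfl
  | cons l ls ih =>
    cases ls with
    | nil => simp [List.intercalate, letters_map_letter]
    | cons l' ls =>
      rw [intercalate_cons_cons, letters_append, letters_append, ih, letters_map_letter]
      rfl

end Token

section FlatPhrase

variable {L : Type u} {n : ℕ} {w : Fin n → List L}

open Token

theorem flatPhrase_eq (w : Fin n → List L) :
    flatPhrase w = [bar].intercalate ((List.ofFn w).map (List.map letter)) := by
  rw [flatPhrase, List.map_ofFn]
  rfl

theorem component_flatPhrase (w : Fin n → List L) (k : Fin n) :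
    component 0 (flatPhrase w) k = w k := by
  rw [flatPhrase_eq, component_intercalate]
  simp

theorem exists_index_of_flatPhrase_eq {A : L} {s t : List (Token L)}
    (h : flatPhrase w = s ++ letter A :: t) : ∃ k : Fin n, (k : ℕ) = bars s := by
  have hA : A ∈ component 0 (flatPhrase w) (bars s) := by
    simp [h, component_append, component]
  rw [flatPhrase_eq, component_intercalate] at hA
  refine ⟨⟨bars s, not_le.1 fun hle => ?_⟩, rfl⟩
  simp [hle] at hA

theorem exists_word_eq_append {l : List L} {s t : List (Token L)}
    (h : flatPhrase w = s ++ l.map letter ++ t) {k : Fin n} (hk : (k : ℕ) = bars s) :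
    ∃ x y, w k = x ++ l ++ y := by
  refine ⟨component 0 s k, component (bars s) t k, ?_⟩
  rw [← component_flatPhrase w k, h]
  simp [component_append, component_map_letter, bars_map_letter, hk]

variable [DecidableEq L] (hw : IsGauss w) {A : L} {s t v : List (Token L)}
  (h : flatPhrase w = s ++ letter A :: t ++ letter A :: v)

include hw h

theorem notMem_letters_of_flatPhrase_eq : A ∉ letters s ∧ A ∉ letters t ∧ A ∉ letters v := by
  have hcount := hw A
  rw [← letters_intercalate, ← flatPhrase_eq, h, letters_append, letters_append,
    List.count_append, List.count_append, letters, letters, List.count_cons_self,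
    List.count_cons_self] at hcount
  refine ⟨?_, ?_, ?_⟩ <;> rw [← List.count_eq_zero] <;> omega

theorem mem_word_iff_of_flatPhrase_eq (k : Fin n) :
    A ∈ w k ↔ (k : ℕ) = bars s ∨ (k : ℕ) = bars s + bars t := by
  obtain ⟨hs, ht, hv⟩ := notMem_letters_of_flatPhrase_eq hw h
  have hs' := mt (mem_letters_of_mem_component (b := 0) (k := k)) hs
  have ht' := mt (mem_letters_of_mem_component (b := bars s) (k := k)) ht
  have hv' := mt (mem_letters_of_mem_component (b := bars s + bars t) (k := k)) hv
  rw [← component_flatPhrase w k, h]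
  simp [component_append, component, hs', ht', hv', eq_comm]

end FlatPhrase

/-! ### Moves that preserve the products along the components -/

section FlatTransfers

open Token

variable {n : ℕ} {L L' : Type u} {Q : Fin n → Type*} [∀ k, Group (Q k)]

/-- In each component, the sequence of symbols `s'` for the rules `r'` can replace the sequence `s`
for the rules `r`; both start in the component `b`. -/
def FlatTransfers (r : ∀ k, ScanRule (Q k) L) (r' : ∀ k, ScanRule (Q k) L') (b : ℕ)
    (s : List (Token L)) (s' : List (Token L')) : Prop :=
  bars s' = bars s ∧ ∀ k : Fin n, (r k).Transfers (r' k) (component b s k) (component b s' k)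

variable {r : ∀ k, ScanRule (Q k) L} {r' : ∀ k, ScanRule (Q k) L'} {b : ℕ}

theorem FlatTransfers.append {s t : List (Token L)} {s' t' : List (Token L')}
    (hs : FlatTransfers r r' b s s') (ht : FlatTransfers r r' (b + bars s) t t') :
    FlatTransfers r r' b (s ++ t) (s' ++ t') := by
  refine ⟨by rw [bars_append, bars_append, hs.1, ht.1], fun k => ?_⟩
  rw [component_append, component_append, hs.1]
  exact (hs.2 k).append (ht.2 k)

theorem FlatTransfers.of_letters {l : List L} {l' : List L'}
    (h : ∀ k : Fin n, (k : ℕ) = b → (r k).Transfers (r' k) l l') :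
    FlatTransfers r r' b (l.map letter) (l'.map letter) := by
  refine ⟨by rw [bars_map_letter, bars_map_letter], fun k => ?_⟩
  rw [component_map_letter, component_map_letter]
  split_ifs with hk
  · exact h k hk.symm
  · exact fun _ _ => ⟨trivial, rfl⟩

theorem FlatTransfers.of_prod_eq_one {l : List L}
    (h : ∀ k : Fin n, (k : ℕ) = b → (r k).prod l = 1) :
    FlatTransfers r r' b (l.map letter) [] :=
  .of_letters (l' := []) fun k hk _ _ => ⟨trivial, (h k hk).symm⟩

end FlatTransfers

namespace Nanophrase

open Token

variable {n : ℕ} {p p' : Nanophrase.{u} AlphaV n} {G : Type*} [Group G] {g : Fin n → G}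
  {m : p.Letter → G} {m' : p'.Letter → G} {f : p'.Letter → p.Letter} {k : Fin n}

theorem transfers_map (hmem : ∀ k X, X ∈ p'.word k ↔ f X ∈ p.word k) {l : List p'.Letter}
    (hsign : ∀ X ∈ l, p'.sign k X = p.sign k (f X)) (hm : ∀ X ∈ l, m' X = m (f X)) :
    (p.rule g m k).Transfers (p'.rule g m' k) (l.map f) l := by
  refine .of_map (fun X hX q h hover => ?_) fun X hX => ?_
  · rw [hm X hX]
    simp only [IsOver, hmem, hsign X hX] at hover
    exact h hover
  · simp only [rule, val, hm X hX, hsign X hX]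

/-- The map `f` preserves the projections of the letters and the components they occur in. -/
structure IsLetterMap (p p' : Nanophrase.{u} AlphaV n) (f : p'.Letter → p.Letter) : Prop where
  proj_eq : ∀ X, p'.proj X = p.proj (f X)
  mem_iff : ∀ k X, X ∈ p'.word k ↔ f X ∈ p.word k

namespace IsLetterMap

protected theorem id : IsLetterMap p p id := ⟨fun _ => rfl, fun _ _ => Iff.rfl⟩

theorem transfers (hf : IsLetterMap p p' f) {l : List p'.Letter}
    (hm : ∀ X ∈ l, m' X = m (f X)) :
    (p.rule g m k).Transfers (p'.rule g m' k) (l.map f) l :=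
  transfers_map hf.mem_iff (fun X _ => by simp only [sign, hf.proj_eq, hf.mem_iff]) hm

theorem flatTransfers (hf : IsLetterMap p p' f) {s : List (Token p'.Letter)}
    (hm : ∀ X ∈ letters s, m' X = m (f X)) (b : ℕ) :
    FlatTransfers (p.rule g m) (p'.rule g m') b (s.map (Token.map f)) s := by
  refine ⟨(bars_map f s).symm, fun k => ?_⟩
  rw [component_map]
  exact hf.transfers fun X hX => hm X (mem_letters_of_mem_component hX)

end IsLetterMap

/-- Each coloring of `p` gives a coloring of `p'` with equivalent longitudes. -/
def TransfersTo {G : Type*} [Group G] (g : Fin n → G) (p p' : Nanophrase.{u} AlphaV n) : Prop :=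
  ∀ m, p.IsColoring g m → ∃ m', p'.IsColoring g m' ∧
    ∀ k, ((p'.longitude m' k : G) : G ⧸ Subgroup.normalClosure {g k}) = (p.longitude m k : G)

theorem TransfersTo.of_transfers
    (h : ∀ m, p.IsColoring g m → ∃ m', ∀ k,
      (p.rule g m k).Transfers (p'.rule g m' k) (p.word k) (p'.word k)) : TransfersTo g p p' := by
  intro m hm
  obtain ⟨m', hm'⟩ := h m hm
  refine ⟨m', fun k => (hm' k 1 (hm k)).1, fun k => ?_⟩
  rw [longitude, longitude, ← rule_prod, ← rule_prod]
  exact (hm' k 1 (hm k)).2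

theorem TransfersTo.of_flatTransfers
    (h : ∀ m, p.IsColoring g m → ∃ m',
      FlatTransfers (p.rule g m) (p'.rule g m') 0 (flatPhrase p.word) (flatPhrase p'.word)) :
    TransfersTo g p p' := by
  refine .of_transfers fun m hm => ?_
  obtain ⟨m', hm'⟩ := h m hm
  refine ⟨m', fun k => ?_⟩
  rw [← component_flatPhrase p.word, ← component_flatPhrase p'.word]
  exact hm'.2 k

theorem transfersTo_iso (f : p.Letter ≃ p'.Letter) (hproj : ∀ A, p'.proj (f A) = p.proj A)
    (hword : ∀ k, p'.word k = (p.word k).map f) : TransfersTo g p p' := by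
  have hf : IsLetterMap p p' f.symm :=
    ⟨fun X => by rw [← hproj, Equiv.apply_symm_apply],
      fun k X => by simp [hword, ← Equiv.eq_symm_apply]⟩
  refine .of_transfers fun m _ => ⟨fun X => m (f.symm X), fun k => ?_⟩
  have hmap : p.word k = (p'.word k).map f.symm := by simp [hword]
  rw [hmap]
  exact hf.transfers fun _ _ => rfl

theorem transfersTo_selfCrossing {L : Type u} [DecidableEq L] {proj : L → AlphaV}
    {w : Fin n → List L} (hw : IsGauss w) {k : Fin n} {A : L} (hk : 2 ≤ (w k).count A)
    (α : AlphaV) :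
    TransfersTo g (⟨L, proj, w, hw⟩ : Nanophrase AlphaV n)
      ⟨L, Function.update proj A α, w, hw⟩ := by
  set p : Nanophrase AlphaV n := ⟨L, proj, w, hw⟩
  set p' : Nanophrase AlphaV n := ⟨L, Function.update proj A α, w, hw⟩
  have hsign : ∀ j, ∀ X ∈ w j, p'.sign j X = p.sign j X := by
    intro j X hX
    by_cases hXA : X = A
    · subst hXA
      have honly : ∀ i, X ∈ w i → i = k := fun i => eq_of_two_le_count (p := p) hk
      obtain rfl := honly j hX
      exact (sign_eq_zero (p := p') honly).trans (sign_eq_zero (p := p) honly).symm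
    · simp only [sign, p, p', Function.update_of_ne hXA]
  refine .of_transfers fun m _ => ⟨m, fun j => ?_⟩
  have h := transfers_map (p := p) (p' := p') (g := g) (m := m) (m' := m) (k := j) (l := w j)
    (fun _ _ => Iff.rfl) (hsign j) fun _ _ => rfl
  rwa [List.map_id'] at h

end Nanophrase

namespace AlphaV

theorem tau_eq {a b : AlphaV} (h : tau a = b) :
    a.fstSign = 0 ∧ b.fstSign = 0 ∧ b.sndSign = -a.sndSign ∨
      a.sndSign = 0 ∧ b.sndSign = 0 ∧ b.fstSign = -a.fstSign := by
  subst h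
  cases a <;> decide

end AlphaV

namespace Nanophrase

open Token

variable {n : ℕ} {p p' : Nanophrase.{u} AlphaV n} {G : Type*} [Group G] {g : Fin n → G}
  {m : p.Letter → G} {k l : Fin n} {ε : SignType} {A B : p.Letter}

theorem IsColoring.exists_holds (hm : p.IsColoring g m) {x v y : List p.Letter}
    (hk : p.word k = x ++ v ++ y) : ∃ q, (p.rule g m k).Holds q v := by
  have h := hm k
  rw [hk, ScanRule.holds_append, ScanRule.holds_append] at h
  exact ⟨_, h.1.2⟩

theorem IsColoring.eq_of_isOver (hm : p.IsColoring g m) {x y : List p.Letter}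
    (hk : p.word k = x ++ [A, B] ++ y) (hA : p.IsOver k A) (hB : p.IsOver k B) : m A = m B := by
  obtain ⟨q, hqA, hqB, -⟩ := hm.exists_holds hk
  have hval : (p.rule g m k).val A = 1 :=
    (congrArg _ (val_eq_one hA.2.1)).trans (QuotientGroup.mk_one _)
  rw [hqA hA, hqB hB, hval, mul_one]

theorem IsCrossing.val_over (h : p.IsCrossing k l ε A) : p.val m k A = 1 :=
  val_eq_one h.sign_over

theorem IsCrossing.val_under (h : p.IsCrossing k l ε A) :
    p.val m l A = if k = l then 1 else m A ^ (ε : ℤ) := by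
  rw [val, h.sign_under]
  split_ifs <;> simp

theorem transfersTo_deletion {f : p'.Letter → p.Letter} (hf : Function.Injective f)
    (hproj : ∀ X, p'.proj X = p.proj (f X)) {l₁ l₂ : List p.Letter}
    (hl : ∀ X, f X ∉ l₁ ∧ f X ∉ l₂) {x y z : List (Token p.Letter)}
    (hp : flatPhrase p.word = x ++ l₁.map letter ++ y ++ l₂.map letter ++ z)
    (hp' : (flatPhrase p'.word).map (Token.map f) = x ++ y ++ z)
    (hprod : ∀ m, p.IsColoring g m → ∀ k : Fin n,
      ((k : ℕ) = bars x → (p.rule g m k).prod l₁ = 1) ∧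
        ((k : ℕ) = bars x + bars y → (p.rule g m k).prod l₂ = 1)) : TransfersTo g p p' := by
  have hfp : IsLetterMap p p' f := by
    refine ⟨hproj, fun k X => ?_⟩
    obtain ⟨hX₁, hX₂⟩ := hl X
    rw [← List.mem_map_of_injective hf, ← component_flatPhrase p.word,
      ← component_flatPhrase p'.word, hp, ← component_map, hp']
    simp only [component_append, component_map_letter, bars_append, bars_map_letter,
      List.mem_append, Nat.add_zero]
    split_ifs <;> simp [hX₁, hX₂]
  obtain ⟨s, z, hs, hxy, rfl⟩ := List.map_eq_append_iff.1 hp'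
  obtain ⟨x, y, rfl, rfl, rfl⟩ := List.map_eq_append_iff.1 hxy
  simp only [bars_map] at hprod
  refine .of_flatTransfers fun m hm => ⟨fun X => m (f X), ?_⟩
  have hmap : ∀ (s : List (Token p'.Letter)) b,
      FlatTransfers (p.rule g m) (p'.rule g fun X => m (f X)) b (s.map (Token.map f)) s :=
    fun s => hfp.flatTransfers fun _ _ => rfl
  have hl₁ : FlatTransfers (p.rule g m) (p'.rule g fun X => m (f X))
      (0 + bars (x.map (Token.map f))) (l₁.map letter) [] :=
    .of_prod_eq_one fun k hk => (hprod m hm k).1 (by simpa only [bars_map, Nat.zero_add] using hk)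
  have hl₂ : FlatTransfers (p.rule g m) (p'.rule g fun X => m (f X))
      (0 + bars (x.map (Token.map f) ++ l₁.map letter ++ y.map (Token.map f)))
      (l₂.map letter) [] :=
    .of_prod_eq_one fun k hk => (hprod m hm k).2 (by
      simpa only [bars_append, bars_map, bars_map_letter, Nat.zero_add, Nat.add_zero] using hk)
  have h := (((((hmap x 0).append hl₁).append (hmap y _)).append hl₂).append (hmap z _))
  rw [hp, hs]
  simpa only [List.append_nil] using h

theorem transfersTo_h1 (A : p.Letter) (f : p'.Letter ≃ {X : p.Letter // X ≠ A})
    (hproj : ∀ X, p'.proj X = p.proj (f X)) (x y : List (Token p.Letter))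
    (hp : flatPhrase p.word = x ++ [letter A, letter A] ++ y)
    (hp' : (flatPhrase p'.word).map (Token.map fun X => (f X : p.Letter)) = x ++ y) :
    TransfersTo g p p' := by
  refine transfersTo_deletion (l₁ := [A, A]) (l₂ := []) (y := [])
    (Subtype.val_injective.comp f.injective) hproj (fun X => by simp [(f X).2])
    (by simpa using hp) (by rw [List.append_nil]; exact hp')
    fun m _ k => ⟨fun hk => ?_, fun _ => rfl⟩
  obtain ⟨u, v, huv⟩ := exists_word_eq_append (l := [A, A]) hp hk
  have hcount : 2 ≤ (p.word k).count A := by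
    rw [huv, List.count_append, List.count_append, List.count_cons_self, List.count_cons_self]
    omega
  have hval : p.val m k A = 1 := val_eq_one (sign_eq_zero fun _ => eq_of_two_le_count hcount)
  rw [rule_prod]
  simp [hval]

theorem IsCrossing.val_eq_inv (hA : p.IsCrossing k l ε A) (hB : p.IsCrossing k l (-ε) B)
    (hm : k ≠ l → m A = m B) {j : Fin n} (hj : A ∈ p.word j) :
    p.val m j B = (p.val m j A)⁻¹ := by
  rcases (hA.mem_iff j).1 hj with rfl | rfl
  · rw [hA.val_over, hB.val_over, inv_one]
  · rw [hA.val_under, hB.val_under]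
    split_ifs with hkl
    · rw [inv_one]
    · rw [hm hkl, SignType.coe_neg, zpow_neg]

theorem transfersTo_h2 (A B : p.Letter) (hτ : AlphaV.tau (p.proj A) = p.proj B)
    (f : p'.Letter ≃ {X : p.Letter // X ≠ A ∧ X ≠ B})
    (hproj : ∀ X, p'.proj X = p.proj (f X)) (x y z : List (Token p.Letter))
    (hp : flatPhrase p.word = x ++ [letter A, letter B] ++ y ++ [letter B, letter A] ++ z)
    (hp' : (flatPhrase p'.word).map (Token.map fun X => (f X : p.Letter)) = x ++ y ++ z) :
    TransfersTo g p p' := by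
  obtain ⟨I, hI⟩ := exists_index_of_flatPhrase_eq (w := p.word) (A := A) (s := x)
    (by simpa using hp)
  obtain ⟨J, hJ⟩ := exists_index_of_flatPhrase_eq (w := p.word) (A := B)
    (s := x ++ [letter A, letter B] ++ y) (by simpa using hp)
  replace hJ : (J : ℕ) = bars x + bars y := by simpa [bars_append, bars] using hJ
  have hAmem : ∀ k, A ∈ p.word k ↔ k = I ∨ k = J := fun k =>
    (mem_word_iff_of_flatPhrase_eq (s := x) (t := [letter B] ++ y ++ [letter B]) (v := z)
      p.gauss (by simp [hp]) k).trans (by simp [Fin.ext_iff, hI, hJ, bars_append, bars])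
  have hBmem : ∀ k, B ∈ p.word k ↔ k = I ∨ k = J := fun k =>
    (mem_word_iff_of_flatPhrase_eq (s := x ++ [letter A]) (t := y) (v := letter A :: z)
      p.gauss (by simp [hp]) k).trans (by simp [Fin.ext_iff, hI, hJ, bars_append, bars])
  obtain ⟨xI, yI, hwI⟩ := exists_word_eq_append (w := p.word) (s := x) (l := [A, B])
    (t := y ++ [letter B, letter A] ++ z) (by simp [hp]) hI
  obtain ⟨xJ, yJ, hwJ⟩ := exists_word_eq_append (w := p.word) (s := x ++ [letter A, letter B] ++ y)
    (l := [B, A]) (t := z) (by simp [hp]) (by simpa [bars_append, bars] using hJ)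
  have hIJ : I ≤ J := Fin.le_def.2 (by omega)
  have hval : ∀ m, p.IsColoring g m → ∀ j, A ∈ p.word j →
      p.val m j B = (p.val m j A)⁻¹ := by
    intro m hm j hj
    rcases AlphaV.tau_eq hτ with ⟨hA, hB, hAB⟩ | ⟨hA, hB, hAB⟩
    · have hcA := isCrossing_of_fstSign_eq_zero hAmem hIJ hA
      have hcB := isCrossing_of_fstSign_eq_zero hBmem hIJ hB
      exact hcA.val_eq_inv (hAB ▸ hcB) (fun hne => hm.eq_of_isOver hwI
        (hcA.isOver_iff.2 ⟨hne, rfl⟩) (hcB.isOver_iff.2 ⟨hne, rfl⟩)) hj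
    · have hcA := isCrossing_of_sndSign_eq_zero hAmem hIJ hA
      have hcB := isCrossing_of_sndSign_eq_zero hBmem hIJ hB
      exact hcA.val_eq_inv (hAB ▸ hcB) (fun hne => (hm.eq_of_isOver hwJ
        (hcB.isOver_iff.2 ⟨hne, rfl⟩) (hcA.isOver_iff.2 ⟨hne, rfl⟩)).symm) hj
  refine transfersTo_deletion (l₁ := [A, B]) (l₂ := [B, A])
    (Subtype.val_injective.comp f.injective) hproj (fun X => by simp [(f X).2])
    (by simpa using hp) hp' fun m hm k => ⟨fun hk => ?_, fun hk => ?_⟩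
  · rw [rule_prod]
    simp [hval m hm k ((hAmem k).2 (.inl (Fin.ext (hk.trans hI.symm))))]
  · rw [rule_prod]
    simp [hval m hm k ((hAmem k).2 (.inr (Fin.ext (hk.trans hJ.symm))))]

end Nanophrase

/-! ### The third move -/

namespace AlphaV

variable {a b c : AlphaV}

theorem weldedTriples_some (h : (some a, some b, some c) ∈ weldedTriples) :
    (a.fstSign = 0 ∧ b.fstSign = 0 ∧ c.fstSign = 0 ∧ a.sndSign = b.sndSign) ∨
    (a.fstSign = 0 ∧ b.fstSign = 0 ∧ c.sndSign = 0 ∧ b.sndSign = a.sndSign) ∨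
    (a.fstSign = 0 ∧ b.sndSign = 0 ∧ c.sndSign = 0 ∧ b.fstSign = c.fstSign) ∨
    (a.sndSign = 0 ∧ b.sndSign = 0 ∧ c.sndSign = 0 ∧ c.fstSign = b.fstSign) ∨
    (a.sndSign = 0 ∧ b.sndSign = 0 ∧ c.fstSign = 0 ∧ c.sndSign = -a.fstSign) ∨
    (a.sndSign = 0 ∧ b.fstSign = 0 ∧ c.fstSign = 0 ∧ a.fstSign = -c.sndSign) := by
  simp only [weldedTriples, Set.mem_insert_iff, Set.mem_singleton_iff, Prod.mk.injEq,
    Option.some.injEq, reduceCtorEq, and_false, false_and, or_false] at h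
  casesm* _ ∨ _, _ ∧ _ <;> subst_vars <;> decide

theorem weldedTriples_some_some_none (h : (some a, some b, none) ∈ weldedTriples) :
    a.fstSign = 0 ∧ b.fstSign = 0 := by
  cases a <;> cases b <;> simp [weldedTriples] at h <;> simp [fstSign]

theorem weldedTriples_some_none_some (h : (some a, none, some c) ∈ weldedTriples) :
    a.sndSign = 0 ∧ c.fstSign = 0 := by
  cases a <;> cases c <;> simp [weldedTriples] at h <;> simp [fstSign, sndSign]

theorem weldedTriples_none_some_some (h : (none, some b, some c) ∈ weldedTriples) :
    b.sndSign = 0 ∧ c.sndSign = 0 := by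
  cases b <;> cases c <;> simp [weldedTriples] at h <;> simp [sndSign]

end AlphaV

namespace Nanophrase

open Token

variable {n : ℕ} {p : Nanophrase.{u} AlphaV n} {G : Type*} [Group G] {g : Fin n → G}
  {m m' : p.Letter → G} {k : Fin n} {A B : p.Letter}

theorem transfers_swap (hA : p.sign k A = 0) (hB : p.sign k B = 0) (hmA : m' A = m A)
    (hmB : m' B = m B) : (p.rule g m k).Transfers (p.rule g m' k) [A, B] [B, A] := by
  have hval : ∀ (m : p.Letter → G) X, p.sign k X = 0 → (p.rule g m k).val X = 1 :=
    fun m X hX => (congrArg _ (val_eq_one hX)).trans (QuotientGroup.mk_one _)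
  rintro q ⟨hqA, hqB, -⟩
  rw [hval m A hA, mul_one] at hqB
  refine ⟨⟨fun h => hmB.trans (hqB h), fun h => ?_, trivial⟩, ?_⟩
  · rw [hval m' B hB, mul_one]
    exact hmA.trans (hqA h)
  · simp [ScanRule.prod, hval, hA, hB]

theorem transfersTo_of_perm {w' : Fin n → List p.Letter} (hw' : IsGauss w')
    {x y z t : List (Token p.Letter)} {l₁ l₂ l₃ l₁' l₂' l₃' : List p.Letter}
    (hp : flatPhrase p.word = x ++ l₁.map letter ++ y ++ l₂.map letter ++ z ++
      l₃.map letter ++ t)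
    (hp' : flatPhrase w' = x ++ l₁'.map letter ++ y ++ l₂'.map letter ++ z ++
      l₃'.map letter ++ t)
    (hl₁ : l₁.Perm l₁') (hl₂ : l₂.Perm l₂') (hl₃ : l₃.Perm l₃')
    (h : ∀ m, p.IsColoring g m → ∃ m' : p.Letter → G,
      (∀ s ∈ [x, y, z, t], ∀ X ∈ letters s, m' X = m X) ∧ ∀ k : Fin n,
        ((k : ℕ) = bars x → (p.rule g m k).Transfers (p.rule g m' k) l₁ l₁') ∧
        ((k : ℕ) = bars x + bars y → (p.rule g m k).Transfers (p.rule g m' k) l₂ l₂') ∧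
        ((k : ℕ) = bars x + bars y + bars z →
          (p.rule g m k).Transfers (p.rule g m' k) l₃ l₃')) :
    TransfersTo g p ⟨p.Letter, p.proj, w', hw'⟩ := by
  have hmem : ∀ k X, X ∈ w' k ↔ X ∈ p.word k := by
    intro k X
    rw [← component_flatPhrase w', ← component_flatPhrase p.word, hp, hp']
    simp only [component_append, component_map_letter, bars_append, bars_map_letter,
      List.mem_append]
    split_ifs <;> simp only [hl₁.mem_iff, hl₂.mem_iff, hl₃.mem_iff]
  have hid : IsLetterMap p ⟨p.Letter, p.proj, w', hw'⟩ id := ⟨fun _ => rfl, hmem⟩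
  refine .of_transfers fun m hm => ?_
  obtain ⟨m', hout, hin⟩ := h m hm
  have houter : ∀ s ∈ [x, y, z, t], ∀ b,
      FlatTransfers (p.rule g m) (p.rule g m') b s s := by
    intro s hs b
    have hs' := IsLetterMap.id.flatTransfers (g := g) (hout s hs) b
    rwa [Token.map_id, List.map_id] at hs'
  have hflat : FlatTransfers (p.rule g m) (p.rule g m') 0 (flatPhrase p.word) (flatPhrase w') := by
    rw [hp, hp']
    refine ((((((houter x (by simp) 0).append
      (.of_letters fun k hk => (hin k).1 ?_)).append
      (houter y (by simp) _)).append
      (.of_letters fun k hk => (hin k).2.1 ?_)).append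
      (houter z (by simp) _)).append
      (.of_letters fun k hk => (hin k).2.2 ?_)).append
      (houter t (by simp) _)
    all_goals simpa only [bars_append, bars_map_letter, Nat.zero_add, Nat.add_zero] using hk
  refine ⟨m', fun k => ?_⟩
  have hk := hflat.2 k
  rw [component_flatPhrase, component_flatPhrase] at hk
  have hk' : (p.rule g m' k).Transfers (rule ⟨p.Letter, p.proj, w', hw'⟩ g m' k)
      ((w' k).map id) (w' k) := hid.transfers fun _ _ => rfl
  rw [List.map_id] at hk'
  exact hk.trans hk'

theorem IsColoring.exists_eq_conjBy (hm : p.IsColoring g m) (hA : p.IsOver k A) :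
    ∃ q, m A = conjBy (g k) q := by
  obtain ⟨x, y, hxy⟩ := List.append_of_mem hA.1
  obtain ⟨q, hq, -⟩ := hm.exists_holds (v := [A]) (hxy.trans (List.append_cons x A y))
  exact ⟨q, hq hA⟩

/-- The letters `X` and `Y`, in this order if `d = 1` and in the other one if `d = -1`. -/
def ordered {L : Type*} (d : ℤˣ) (X Y : L) : List L := if d = 1 then [X, Y] else [Y, X]

theorem ordered_one {L : Type*} (X Y : L) : ordered 1 X Y = [X, Y] := rfl

theorem ordered_neg_one {L : Type*} (X Y : L) : ordered (-1) X Y = [Y, X] := rfl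

/-- A component `T` that passes over the components `M` and `B`, where `M` passes over `B`. The
letters `P`, `Q`, `R` are the crossings of `T` with `M`, of `T` with `B` and of `M` with `B`;
`d₁`, `d₂`, `d₃` are the orders in which they are met along `T`, `M` and `B`. -/
structure IsTriangle (p : Nanophrase.{u} AlphaV n) (T M B : Fin n) (d₁ d₂ d₃ : ℤˣ)
    (P Q R : p.Letter) : Prop where
  P_ne_R : P ≠ R
  Q_ne_R : Q ≠ R
  adjacent : ∃ x y, p.word T = x ++ ordered d₁ P Q ++ y
  crossings : ∃ e₁ e₂ e₃ : SignType, p.IsCrossing T M e₁ P ∧ p.IsCrossing T B e₂ Q ∧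
    p.IsCrossing M B e₃ R ∧ (d₂ * e₁ : ℤ) = d₃ * e₂

namespace IsTriangle

variable {T M B : Fin n} {d₁ d₂ d₃ : ℤˣ} {P Q R : p.Letter}

/-- Whether the strand of `B` is conjugated by its crossing with `T` or by that of `M` with `T`
makes no difference. -/
theorem mk_conj_eq (h : p.IsTriangle T M B d₁ d₂ d₃ P Q R)
    (hg : ∀ k, CommutesWithConjugates (g k)) (hm : p.IsColoring g m) :
    ((MulAut.conj (p.val m M P ^ (d₂ : ℤ)) (p.val m B R) : G) :
        G ⧸ Subgroup.normalClosure {g B}) =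
      MulAut.conj (p.val m B Q ^ (d₃ : ℤ)) (p.val m B R) := by
  obtain ⟨x, y, hxy⟩ := h.adjacent
  obtain ⟨e₁, e₂, e₃, hP, hQ, hR, hsign⟩ := h.crossings
  by_cases hMB : M = B
  · rw [hR.val_under, if_pos hMB, map_one, map_one]
  by_cases hTM : T = M
  · subst hTM
    obtain ⟨q, hq⟩ := hm.exists_eq_conjBy (hQ.isOver_iff.2 ⟨hMB, rfl⟩)
    obtain ⟨r, hr⟩ := hm.exists_eq_conjBy (hR.isOver_iff.2 ⟨hMB, rfl⟩)
    have hcomm : Commute (m Q) (m R) := hq ▸ hr ▸ (hg T).commute_conjBy q r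
    rw [hP.val_under, hQ.val_under, hR.val_under, if_pos rfl, if_neg hMB, one_zpow, map_one,
      MulAut.one_apply, MulAut.conj_apply, if_neg hMB, (hcomm.zpow_zpow e₂ e₃).zpow_left d₃ |>.eq,
      mul_inv_cancel_right]
  by_cases hTB : T = B
  · subst hTB
    obtain ⟨q, hq⟩ := hm.exists_eq_conjBy (hP.isOver_iff.2 ⟨hTM, rfl⟩)
    have hone : ((m P : G) : G ⧸ Subgroup.normalClosure {g T}) = 1 := hq ▸ mk_conjBy q
    rw [hP.val_under, hQ.val_over, if_neg hTM, one_zpow, map_one, MulAut.one_apply,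
      MulAut.conj_apply]
    simp [hone]
  · have hPover := hP.isOver_iff.2 ⟨hTM, rfl⟩
    have hQover := hQ.isOver_iff.2 ⟨hTB, rfl⟩
    have hPQ : m P = m Q := by
      rw [ordered] at hxy
      split_ifs at hxy
      · exact hm.eq_of_isOver hxy hPover hQover
      · exact (hm.eq_of_isOver hxy hQover hPover).symm
    rw [hP.val_under, hQ.val_under, if_neg hTM, if_neg hTB, ← zpow_mul, ← zpow_mul, hPQ,
      mul_comm (e₁ : ℤ), hsign, mul_comm (e₂ : ℤ)]

/-- The values of the letters after the move, which changes only that of `R`. -/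
def newValue (m : p.Letter → G) (M : Fin n) (d₂ : ℤˣ) (P R : p.Letter) : p.Letter → G :=
  Function.update m R (MulAut.conj (p.val m M P ^ (d₂ : ℤ)) (m R))

theorem transfers_top (h : p.IsTriangle T M B d₁ d₂ d₃ P Q R) :
    (p.rule g m T).Transfers (p.rule g (newValue m M d₂ P R) T) (ordered d₁ P Q)
      (ordered (-d₁) P Q) := by
  obtain ⟨e₁, e₂, e₃, hP, hQ, -⟩ := h.crossings
  have hmP : newValue m M d₂ P R P = m P := Function.update_of_ne h.P_ne_R _ _
  have hmQ : newValue m M d₂ P R Q = m Q := Function.update_of_ne h.Q_ne_R _ _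
  rcases Int.units_eq_one_or d₁ with rfl | rfl
  · exact transfers_swap hP.sign_over hQ.sign_over hmP hmQ
  · exact transfers_swap hQ.sign_over hP.sign_over hmQ hmP

theorem transfers_middle (h : p.IsTriangle T M B d₁ d₂ d₃ P Q R)
    (hg : ∀ k, CommutesWithConjugates (g k)) :
    (p.rule g m M).Transfers (p.rule g (newValue m M d₂ P R) M) (ordered d₂ P R)
      (ordered (-d₂) P R) := by
  obtain ⟨e₁, e₂, e₃, hP, -, hR, -⟩ := h.crossings
  have hmR : newValue m M d₂ P R R = MulAut.conj (p.val m M P ^ (d₂ : ℤ)) (m R) :=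
    Function.update_self ..
  have hvalP : p.val (newValue m M d₂ P R) M P = p.val m M P := by
    rw [val, val, newValue, Function.update_of_ne h.P_ne_R]
  have hvalR : ∀ m : p.Letter → G, p.val m M R = 1 := fun m => hR.val_over
  have hnot : ¬ p.IsOver M P := fun ho => (hP.isOver_iff.1 ho).1 (hP.isOver_iff.1 ho).2.symm
  rcases Int.units_eq_one_or d₂ with rfl | rfl
  · rintro q ⟨-, hq, -⟩
    refine ⟨⟨fun ho => ?_, fun ho => absurd ho hnot, trivial⟩, ?_⟩
    · rw [hmR, hq ho, rule, (hg M).conjBy_mul]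
      simp [mul_assoc]
    · simp [rule_prod, ordered_one, ordered_neg_one, hvalP, hvalR]
  · rintro q ⟨hq, -, -⟩
    refine ⟨⟨fun ho => absurd ho hnot, fun ho => ?_, trivial⟩, ?_⟩
    · have hval : (p.rule g (newValue m M (-1) P R) M).val P = (p.val m M P : G) :=
        congrArg _ hvalP
      rw [hmR, hq ho, hval, (hg M).conjBy_mul]
      simp
    · simp [rule_prod, ordered_one, ordered_neg_one, hvalP, hvalR]

theorem transfers_bottom (h : p.IsTriangle T M B d₁ d₂ d₃ P Q R)
    (hg : ∀ k, CommutesWithConjugates (g k)) (hm : p.IsColoring g m) :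
    (p.rule g m B).Transfers (p.rule g (newValue m M d₂ P R) B) (ordered d₃ Q R)
      (ordered (-d₃) Q R) := by
  obtain ⟨e₁, e₂, e₃, -, hQ, hR, -⟩ := h.crossings
  have hvalQ : p.val (newValue m M d₂ P R) B Q = p.val m B Q := by
    rw [val, val, newValue, Function.update_of_ne h.Q_ne_R]
  have hvalR : p.val (newValue m M d₂ P R) B R =
      MulAut.conj (p.val m M P ^ (d₂ : ℤ)) (p.val m B R) := by
    rw [val, newValue, Function.update_self]
    exact (map_zpow _ _ _).symm
  have hnot : ∀ {C e X}, p.IsCrossing C B e X → ¬ p.IsOver B X :=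
    fun hX ho => (hX.isOver_iff.1 ho).1 (hX.isOver_iff.1 ho).2.symm
  have hconj := h.mk_conj_eq hg hm
  rw [← hvalR] at hconj
  rcases Int.units_eq_one_or d₃ with rfl | rfl <;>
  refine fun q _ => ⟨⟨fun ho => absurd ho (hnot ‹_›), fun ho => absurd ho (hnot ‹_›), trivial⟩, ?_⟩
  · simp [rule_prod, ordered_one, ordered_neg_one, hvalQ, hconj]
  · simp [rule_prod, ordered_one, ordered_neg_one, hvalQ, hconj, mul_assoc]

theorem exists_transfers (h : p.IsTriangle T M B d₁ d₂ d₃ P Q R)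
    (hg : ∀ k, CommutesWithConjugates (g k)) (hm : p.IsColoring g m) :
    ∃ m' : p.Letter → G, (∀ X ≠ R, m' X = m X) ∧
      (p.rule g m T).Transfers (p.rule g m' T) (ordered d₁ P Q) (ordered (-d₁) P Q) ∧
      (p.rule g m M).Transfers (p.rule g m' M) (ordered d₂ P R) (ordered (-d₂) P R) ∧
      (p.rule g m B).Transfers (p.rule g m' B) (ordered d₃ Q R) (ordered (-d₃) Q R) :=
  ⟨newValue m M d₂ P R, fun _ hX => Function.update_of_ne hX _ _, h.transfers_top,
    h.transfers_middle hg, h.transfers_bottom hg hm⟩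

end IsTriangle

/-- The letters `A`, `B`, `C` are distinct, and their occurrences are in factors `AB`, `AC`, `BC`
of the components `I ≤ J ≤ K`. -/
structure IsThirdMoveSite (p : Nanophrase.{u} AlphaV n) (I J K : Fin n) (A B C : p.Letter) :
    Prop where
  I_le_J : I ≤ J
  J_le_K : J ≤ K
  A_ne_B : A ≠ B
  A_ne_C : A ≠ C
  B_ne_C : B ≠ C
  mem_A : ∀ k, A ∈ p.word k ↔ k = I ∨ k = J
  mem_B : ∀ k, B ∈ p.word k ↔ k = I ∨ k = K
  mem_C : ∀ k, C ∈ p.word k ↔ k = J ∨ k = K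
  word_I : ∃ x y, p.word I = x ++ [A, B] ++ y
  word_J : ∃ x y, p.word J = x ++ [A, C] ++ y
  word_K : ∃ x y, p.word K = x ++ [B, C] ++ y

namespace IsThirdMoveSite

variable {I J K : Fin n} {A B C : p.Letter}

theorem exists_isTriangle (h : p.IsThirdMoveSite I J K A B C)
    (hS : (some (p.proj A), some (p.proj B), some (p.proj C)) ∈ AlphaV.weldedTriples) :
    p.IsTriangle I J K 1 1 1 A B C ∨ p.IsTriangle I K J (-1) 1 1 B A C ∨
    p.IsTriangle K I J 1 (-1) (-1) B C A ∨ p.IsTriangle K J I (-1) (-1) (-1) C B A ∨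
    p.IsTriangle J K I (-1) (-1) 1 C A B ∨ p.IsTriangle J I K 1 1 (-1) A C B := by
  have fstA := isCrossing_of_fstSign_eq_zero h.mem_A h.I_le_J
  have fstB := isCrossing_of_fstSign_eq_zero h.mem_B (h.I_le_J.trans h.J_le_K)
  have fstC := isCrossing_of_fstSign_eq_zero h.mem_C h.J_le_K
  have sndA := isCrossing_of_sndSign_eq_zero h.mem_A h.I_le_J
  have sndB := isCrossing_of_sndSign_eq_zero h.mem_B (h.I_le_J.trans h.J_le_K)
  have sndC := isCrossing_of_sndSign_eq_zero h.mem_C h.J_le_K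
  rcases AlphaV.weldedTriples_some hS with ⟨hA, hB, hC, hs⟩ | ⟨hA, hB, hC, hs⟩ |
    ⟨hA, hB, hC, hs⟩ | ⟨hA, hB, hC, hs⟩ | ⟨hA, hB, hC, hs⟩ | ⟨hA, hB, hC, hs⟩
  · exact .inl ⟨h.A_ne_C, h.B_ne_C, h.word_I, _, _, _, fstA hA, fstB hB, fstC hC, by simp [hs]⟩
  · exact .inr <| .inl
      ⟨h.B_ne_C, h.A_ne_C, h.word_I, _, _, _, fstB hB, fstA hA, sndC hC, by simp [hs]⟩
  · exact .inr <| .inr <| .inl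
      ⟨h.A_ne_B.symm, h.A_ne_C.symm, h.word_K, _, _, _, sndB hB, sndC hC, fstA hA, by simp [hs]⟩
  · exact .inr <| .inr <| .inr <| .inl
      ⟨h.A_ne_C.symm, h.A_ne_B.symm, h.word_K, _, _, _, sndC hC, sndB hB, sndA hA, by simp [hs]⟩
  · exact .inr <| .inr <| .inr <| .inr <| .inl
      ⟨h.B_ne_C.symm, h.A_ne_B, h.word_J, _, _, _, fstC hC, sndA hA, sndB hB, by simp [hs]⟩
  · exact .inr <| .inr <| .inr <| .inr <| .inr
      ⟨h.A_ne_B, h.B_ne_C.symm, h.word_J, _, _, _, sndA hA, fstC hC, fstB hB, by simp [hs]⟩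

theorem exists_transfers (h : p.IsThirdMoveSite I J K A B C)
    (hS : (some (p.proj A), some (p.proj B), some (p.proj C)) ∈ AlphaV.weldedTriples)
    (hg : ∀ k, CommutesWithConjugates (g k)) (hm : p.IsColoring g m) :
    ∃ m' : p.Letter → G, (∀ X, X ≠ A → X ≠ B → X ≠ C → m' X = m X) ∧
      (p.rule g m I).Transfers (p.rule g m' I) [A, B] [B, A] ∧
      (p.rule g m J).Transfers (p.rule g m' J) [A, C] [C, A] ∧
      (p.rule g m K).Transfers (p.rule g m' K) [B, C] [C, B] := by
  rcases h.exists_isTriangle hS with h | h | h | h | h | h <;>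
  obtain ⟨m', hout, hT, hM, hB⟩ := h.exists_transfers hg hm <;>
  refine ⟨m', fun X hA hB hC => hout X ‹_›, ?_, ?_, ?_⟩ <;> assumption

end IsThirdMoveSite

section TwoOccurrences

variable {s t v : List (Token p.Letter)}
  (h : flatPhrase p.word = s ++ letter A :: t ++ letter A :: v)

include h

theorem exists_mem_word_iff :
    ∃ i j : Fin n, (i : ℕ) = bars s ∧ (j : ℕ) = bars s + bars t ∧
      ∀ k, A ∈ p.word k ↔ k = i ∨ k = j := by
  obtain ⟨i, hi⟩ := exists_index_of_flatPhrase_eq (h.trans (List.append_assoc s _ _))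
  obtain ⟨j, hj⟩ := exists_index_of_flatPhrase_eq h
  rw [bars_append, bars] at hj
  refine ⟨i, j, hi, hj, fun k => ?_⟩
  rw [mem_word_iff_of_flatPhrase_eq p.gauss h, Fin.ext_iff, Fin.ext_iff, hi, hj]

theorem sign_eq_zero_of_fstSign (hA : (p.proj A).fstSign = 0) (hk : (k : ℕ) = bars s) :
    p.sign k A = 0 := by
  obtain ⟨i, j, hi, hj, hmem⟩ := exists_mem_word_iff h
  obtain rfl : k = i := Fin.ext (hk.trans hi.symm)
  exact (isCrossing_of_fstSign_eq_zero hmem (Fin.le_def.2 (by omega)) hA).sign_over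

theorem sign_eq_zero_of_sndSign (hA : (p.proj A).sndSign = 0)
    (hk : (k : ℕ) = bars s + bars t) : p.sign k A = 0 := by
  obtain ⟨i, j, hi, hj, hmem⟩ := exists_mem_word_iff h
  obtain rfl : k = j := Fin.ext (hk.trans hj.symm)
  exact (isCrossing_of_sndSign_eq_zero hmem (Fin.le_def.2 (by omega)) hA).sign_over

end TwoOccurrences

section ThirdMove

variable {A B C : p.Letter} {x y z t : List (Token p.Letter)}
  (hp : flatPhrase p.word = x ++ [A, B].map letter ++ y ++ [A, C].map letter ++ z ++
    [B, C].map letter ++ t)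

include hp

theorem ne_of_flatPhrase_eq :
    A ≠ B ∧ A ≠ C ∧ B ≠ C ∧
      ∀ s ∈ [x, y, z, t], ∀ X ∈ letters s, X ≠ A ∧ X ≠ B ∧ X ≠ C := by
  have hA := notMem_letters_of_flatPhrase_eq (s := x) (A := A) (t := letter B :: y)
    (v := letter C :: z ++ [letter B, letter C] ++ t) p.gauss (by simp [hp])
  have hB := notMem_letters_of_flatPhrase_eq (s := x ++ [letter A]) (A := B)
    (t := y ++ [letter A, letter C] ++ z) (v := letter C :: t) p.gauss (by simp [hp])
  have hC := notMem_letters_of_flatPhrase_eq (s := x ++ [letter A, letter B] ++ y ++ [letter A])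
    (A := C) (t := z ++ [letter B]) (v := t) p.gauss (by simp [hp])
  simp only [letters_append, letters, List.mem_append, List.mem_cons, List.not_mem_nil, or_false,
    not_or, List.cons_append] at hA hB hC
  refine ⟨hA.2.1.1, hA.2.2.1, hB.2.2.1, ?_⟩
  simp only [List.forall_mem_cons, List.not_mem_nil, false_imp_iff, implies_true, and_true]
  refine ⟨?_, ?_, ?_, ?_⟩ <;> intro X hX <;> refine ⟨?_, ?_, ?_⟩ <;> rintro rfl <;> tauto

theorem exists_isThirdMoveSite :
    ∃ I J K : Fin n, (I : ℕ) = bars x ∧ (J : ℕ) = bars x + bars y ∧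
      (K : ℕ) = bars x + bars y + bars z ∧ p.IsThirdMoveSite I J K A B C := by
  obtain ⟨hAB, hAC, hBC, -⟩ := ne_of_flatPhrase_eq hp
  obtain ⟨I, hI⟩ := exists_index_of_flatPhrase_eq (w := p.word) (A := A) (s := x)
    (t := letter B :: (y ++ [A, C].map letter ++ z ++ [B, C].map letter ++ t)) (by simp [hp])
  obtain ⟨J, hJ⟩ := exists_index_of_flatPhrase_eq (w := p.word) (A := A)
    (s := x ++ [A, B].map letter ++ y) (t := letter C :: (z ++ [B, C].map letter ++ t))
    (by simp [hp])
  obtain ⟨K, hK⟩ := exists_index_of_flatPhrase_eq (w := p.word) (A := B)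
    (s := x ++ [A, B].map letter ++ y ++ [A, C].map letter ++ z) (t := letter C :: t)
    (by simp [hp])
  have hwI := exists_word_eq_append (w := p.word) (l := [A, B]) (s := x)
    (t := y ++ [A, C].map letter ++ z ++ [B, C].map letter ++ t) (by simp [hp]) hI
  have hwJ := exists_word_eq_append (w := p.word) (l := [A, C])
    (s := x ++ [A, B].map letter ++ y) (t := z ++ [B, C].map letter ++ t) (by simp [hp]) hJ
  have hwK := exists_word_eq_append (l := [B, C]) hp hK
  simp only [bars_append, bars_map_letter, Nat.add_zero] at hJ hK
  refine ⟨I, J, K, hI, hJ, hK, Fin.le_def.2 (by omega), Fin.le_def.2 (by omega), hAB, hAC, hBC,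
    fun k => ?_, fun k => ?_, fun k => ?_, hwI, hwJ, hwK⟩
  · rw [mem_word_iff_of_flatPhrase_eq (s := x) (A := A) (t := letter B :: y)
      (v := letter C :: z ++ [letter B, letter C] ++ t) p.gauss (by simp [hp])]
    simp [Fin.ext_iff, hI, hJ, bars]
  · rw [mem_word_iff_of_flatPhrase_eq (s := x ++ [letter A]) (A := B)
      (t := y ++ [letter A, letter C] ++ z) (v := letter C :: t) p.gauss (by simp [hp])]
    simp [Fin.ext_iff, hI, hK, bars_append, bars, add_assoc]
  · rw [mem_word_iff_of_flatPhrase_eq (s := x ++ [letter A, letter B] ++ y ++ [letter A])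
      (A := C) (t := z ++ [letter B]) (v := t) p.gauss (by simp [hp])]
    simp [Fin.ext_iff, hJ, hK, bars_append, bars, add_assoc]

end ThirdMove

theorem transfersTo_h3_some (hg : ∀ k, CommutesWithConjugates (g k))
    {w' : Fin n → List p.Letter} (hw' : IsGauss w') {C : p.Letter}
    (hS : (some (p.proj A), some (p.proj B), some (p.proj C)) ∈ AlphaV.weldedTriples)
    (x y z t : List (Token p.Letter))
    (hp : flatPhrase p.word = x ++ [A, B].map letter ++ y ++ [A, C].map letter ++ z ++
      [B, C].map letter ++ t)
    (hp' : flatPhrase w' = x ++ [B, A].map letter ++ y ++ [C, A].map letter ++ z ++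
      [C, B].map letter ++ t) :
    TransfersTo g p ⟨p.Letter, p.proj, w', hw'⟩ := by
  refine transfersTo_of_perm hw' hp hp' (.swap _ _ _) (.swap _ _ _) (.swap _ _ _) fun m hm => ?_
  obtain ⟨-, -, -, hne⟩ := ne_of_flatPhrase_eq hp
  obtain ⟨I, J, K, hI, hJ, hK, hsite⟩ := exists_isThirdMoveSite hp
  obtain ⟨m', hout, htI, htJ, htK⟩ := hsite.exists_transfers hS hg hm
  refine ⟨m', fun s hs X hX => ?_, fun k => ⟨fun hk => ?_, fun hk => ?_, fun hk => ?_⟩⟩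
  · obtain ⟨hA, hB, hC⟩ := hne s hs X hX
    exact hout X hA hB hC
  · exact Fin.ext (hk.trans hI.symm) ▸ htI
  · exact Fin.ext (hk.trans hJ.symm) ▸ htJ
  · exact Fin.ext (hk.trans hK.symm) ▸ htK

theorem transfersTo_swap {w' : Fin n → List p.Letter} (hw' : IsGauss w')
    (s t : List (Token p.Letter)) (hp : flatPhrase p.word = s ++ [A, B].map letter ++ t)
    (hp' : flatPhrase w' = s ++ [B, A].map letter ++ t)
    (hA : ∀ k : Fin n, (k : ℕ) = bars s → p.sign k A = 0)
    (hB : ∀ k : Fin n, (k : ℕ) = bars s → p.sign k B = 0) :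
    TransfersTo g p ⟨p.Letter, p.proj, w', hw'⟩ := by
  have hnil : ∀ (m : p.Letter → G) k, (p.rule g m k).Transfers (p.rule g m k) [] [] :=
    fun _ _ _ h => ⟨h, rfl⟩
  exact transfersTo_of_perm hw' (x := s) (y := t) (z := []) (t := []) (l₂ := []) (l₃ := [])
    (by simp [hp]) (by simp [hp']) (.swap _ _ _) .nil .nil fun m _ =>
      ⟨m, fun _ _ _ _ => rfl, fun k => ⟨fun hk => transfers_swap (hA k hk) (hB k hk) rfl rfl,
        fun _ => hnil m k, fun _ => hnil m k⟩⟩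

theorem transfersTo_h3 (hg : ∀ k, CommutesWithConjugates (g k)) {w' : Fin n → List p.Letter}
    (hw' : IsGauss w') (A B C : Option p.Letter)
    (hS : (A.map p.proj, B.map p.proj, C.map p.proj) ∈ AlphaV.weldedTriples)
    (x y z t : List (Token p.Letter))
    (hp : flatPhrase p.word = x ++ ofOption A ++ ofOption B ++ y ++ ofOption A ++ ofOption C ++
      z ++ ofOption B ++ ofOption C ++ t)
    (hp' : flatPhrase w' = x ++ ofOption B ++ ofOption A ++ y ++ ofOption C ++ ofOption A ++
      z ++ ofOption C ++ ofOption B ++ t) :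
    TransfersTo g p ⟨p.Letter, p.proj, w', hw'⟩ := by
  rcases A with _ | A <;> rcases B with _ | B <;> rcases C with _ | C <;>
    simp only [ofOption, Option.map_none, Option.map_some, List.append_nil] at hp hp' hS
  case some.some.some =>
    exact transfersTo_h3_some hg hw' hS x y z t (by simp [hp]) (by simp [hp'])
  case some.some.none =>
    obtain ⟨hA, hB⟩ := AlphaV.weldedTriples_some_some_none hS
    refine transfersTo_swap hw' x (y ++ letter A :: z ++ letter B :: t) (A := A) (B := B)
      (by simp [hp]) (by simp [hp'])
      (fun k hk => sign_eq_zero_of_fstSign (s := x) (t := letter B :: y) (v := z ++ letter B :: t)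
        (by simp [hp]) hA hk)
      (fun k hk => sign_eq_zero_of_fstSign (s := x ++ [letter A]) (t := y ++ letter A :: z)
        (v := t) (by simp [hp]) hB (by simp [hk, bars_append, bars]))
  case some.none.some =>
    obtain ⟨hA, hC⟩ := AlphaV.weldedTriples_some_none_some hS
    refine transfersTo_swap hw' (x ++ letter A :: y) (z ++ letter C :: t) (A := A) (B := C)
      (by simp [hp]) (by simp [hp'])
      (fun k hk => sign_eq_zero_of_sndSign (s := x) (t := y) (v := letter C :: z ++ letter C :: t)
        (by simp [hp]) hA (by simp [hk, bars_append, bars]))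
      (fun k hk => sign_eq_zero_of_fstSign (s := x ++ letter A :: y ++ [letter A]) (t := z)
        (v := t) (by simp [hp]) hC (by simp [hk, bars_append, bars]))
  case none.some.some =>
    obtain ⟨hB, hC⟩ := AlphaV.weldedTriples_none_some_some hS
    refine transfersTo_swap hw' (x ++ letter B :: y ++ letter C :: z) t (A := B) (B := C)
      (by simp [hp]) (by simp [hp'])
      (fun k hk => sign_eq_zero_of_sndSign (s := x) (t := y ++ letter C :: z) (v := letter C :: t)
        (by simp [hp]) hB (by simp [hk, bars_append, bars]))
      (fun k hk => sign_eq_zero_of_sndSign (s := x ++ letter B :: y) (t := z ++ [letter B])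
        (v := t) (by simp [hp]) hC (by simp [hk, bars_append, bars, add_assoc]))
  all_goals simp [AlphaV.weldedTriples] at hS

end Nanophrase

/-! ### The residue classes -/

namespace Nanophrase

variable {n : ℕ} {s e f : List (Fin n)}

theorem mem_lowerSequences : e ∈ lowerSequences s ↔
    2 ≤ e.length ∧ ∃ d, d.Sublist s ∧ d.length < s.length ∧ e.IsRotated d := by
  simp only [lowerSequences, List.mem_toFinset, List.mem_filter, List.mem_flatMap,
    List.mem_sublists, List.mem_cyclicPermutations_iff, decide_eq_true_eq, and_assoc]
  exact and_comm

theorem exists_sublist_isRotated {α : Type*} {d e f : List α} (hfe : f.Sublist e)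
    (hed : e.IsRotated d) : ∃ f', f'.Sublist d ∧ f.IsRotated f' := by
  obtain ⟨k, hk, rfl⟩ := List.isRotated_iff_mod.1 hed.symm
  rw [List.rotate_eq_drop_append_take hk] at hfe
  obtain ⟨a, b, rfl, ha, hb⟩ := List.sublist_append_iff.1 hfe
  exact ⟨b ++ a, List.take_append_drop k d ▸ hb.append ha, List.isRotated_append⟩

theorem mem_lowerSequences_trans (he : e ∈ lowerSequences s) (hf : f ∈ lowerSequences e) :
    f ∈ lowerSequences s ∧ f.length < e.length := by
  rw [mem_lowerSequences] at he hf ⊢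
  obtain ⟨-, d, hd, hds, hed⟩ := he
  obtain ⟨hf2, d', hd', hde, hfd⟩ := hf
  obtain ⟨f', hf', hdf⟩ := exists_sublist_isRotated hd' hed
  have hlen := (hfd.trans hdf).perm.length_eq
  have hlen' := hed.perm.length_eq
  have hlt := hfd.perm.length_eq.trans_lt hde
  exact ⟨⟨hf2, f', hf'.trans hd, by omega, hfd.trans hdf⟩, hlt⟩

theorem nodup_of_mem_lowerSequences (hs : s.Nodup) (he : e ∈ lowerSequences s) : e.Nodup := by
  obtain ⟨-, d, hd, -, hed⟩ := mem_lowerSequences.1 he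
  exact hed.nodup_iff.2 (hd.nodup hs)

theorem muSeq_append (p : Nanophrase.{u} AlphaV n) (d : List (Fin n)) (i : Fin n) :
    p.muSeq (d ++ [i]) = p.mu d i := by
  simp [muSeq]

variable {p p' : Nanophrase.{u} AlphaV n} {c : List (Fin n)} {i : Fin n}

/-- Modulo every number that divides the lower coefficients of both phrases, the coefficients of
`p` and `p'` agree. -/
def MuCongruent (p p' : Nanophrase.{u} AlphaV n) : Prop :=
  ∀ (c : List (Fin n)) (i : Fin n), (c ++ [i]).Nodup → ∀ N : ℤ,
    (∀ e ∈ lowerSequences (c ++ [i]), N ∣ p.muSeq e ∧ N ∣ p'.muSeq e) →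
      p.mu c i ≡ p'.mu c i [ZMOD N]

namespace MuCongruent

theorem symm (h : MuCongruent p p') : MuCongruent p' p :=
  fun c i hn N hN => (h c i hn N fun e he => (hN e he).symm).symm

theorem dvd_muSeq (h : MuCongruent p p') (hs : s.Nodup) {N : ℤ}
    (hN : ∀ e ∈ lowerSequences s, N ∣ p.muSeq e) (he : e ∈ lowerSequences s) :
    N ∣ p'.muSeq e := by
  induction hl : e.length using Nat.strong_induction_on generalizing e with
  | _ l ih =>
    have htwo := (mem_lowerSequences.1 he).1
    have hne : e ≠ [] := List.length_pos_iff.1 (by omega)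
    obtain ⟨d, i, rfl⟩ : ∃ d i, e = d ++ [i] := ⟨_, _, (List.dropLast_append_getLast hne).symm⟩
    have hcong := h d i (nodup_of_mem_lowerSequences hs he) N fun f hf => by
      obtain ⟨hfs, hlt⟩ := mem_lowerSequences_trans he hf
      exact ⟨hN f hfs, ih f.length (hl ▸ hlt) hfs rfl⟩
    have hdvd := hN _ he
    rw [muSeq_append] at hdvd ⊢
    exact (Int.ModEq.dvd_iff hcong).1 hdvd

theorem delta_dvd (h : MuCongruent p p') (hn : (c ++ [i]).Nodup) : p.delta c i ∣ p'.delta c i :=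
  Finset.dvd_gcd fun _ he => h.dvd_muSeq hn (fun _ he' => Finset.gcd_dvd he') he

theorem mubar_eq (h : MuCongruent p p') (hn : (c ++ [i]).Nodup) :
    p.mubar c i = p'.mubar c i := by
  have hdelta : p.delta c i = p'.delta c i :=
    dvd_antisymm_of_normalize_eq Finset.normalize_gcd Finset.normalize_gcd
      (h.delta_dvd hn) (h.symm.delta_dvd hn)
  have hmu : p.mu c i ≡ p'.mu c i [ZMOD p.delta c i] :=
    h c i hn _ fun e he => ⟨Finset.gcd_dvd he, hdelta ▸ Finset.gcd_dvd he⟩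
  ext m
  rw [mubar, mubar, Set.mem_ofPred_eq, Set.mem_ofPred_eq, ← hdelta]
  exact ⟨fun hm => hm.trans hmu, fun hm => hm.trans hmu.symm⟩

end MuCongruent

theorem muCongruent_of_cast_eq
    (h : ∀ (c : List (Fin n)) (i : Fin n), (c ++ [i]).Nodup → ∀ R : Type, [CommRing R] →
      (∀ e ∈ lowerSequences (c ++ [i]), (p.muSeq e : R) = 0 ∧ (p'.muSeq e : R) = 0) →
        (p.mu c i : R) = p'.mu c i) : MuCongruent p p' := by
  intro c i hn N hN
  have hcast : ∀ z : ℤ, (z : ZMod N.natAbs) = 0 ↔ N ∣ z := fun z => by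
    rw [ZMod.intCast_zmod_eq_zero_iff_dvd, Int.natAbs_dvd]
  have hmu := h c i hn (ZMod N.natAbs) fun e he =>
    ⟨(hcast _).2 (hN e he).1, (hcast _).2 (hN e he).2⟩
  rw [Int.modEq_iff_dvd, ← hcast, Int.cast_sub, hmu, sub_self]

end Nanophrase

/-! ### Colorings by unitriangular matrices -/

namespace unitriangular

variable {n : ℕ} {c : List (Fin n)} (hc : c.Nodup) {R : Type*} [CommRing R]

theorem commute_meridian {k : Fin n} {x : unitriangular c R}
    (h : ∀ a b, a ≠ b → toMatrix x a b ≠ 0 → ¬ (k :: gapInterval c a b).Sublist c ∧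
      ¬ (gapInterval c a b ++ [k]).Sublist c) : Commute (meridian hc R k) x := by
  have hsupp : Supported (fun d => ¬ (k :: d).Sublist c ∧ ¬ (d ++ [k]).Sublist c)
      (toMatrix x - 1) := by
    intro a b hab
    obtain ⟨hle, hlen⟩ := degreeGE_toMatrix_sub_one x a b hab
    have hne : a ≠ b := by
      rintro rfl
      simp [gapInterval_self] at hlen
    rw [Matrix.sub_apply, Matrix.one_apply_ne hne, sub_zero] at hab
    exact ⟨hle, h a b hne hab⟩
  have hleft : kappa c R k * (toMatrix x - 1) = 0 :=
    (Supported.mul (W := fun d => ¬ d.Sublist c)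
      (fun _ y hk hy h => hy.1 ((hk.append_right y).trans h)) (supported_kappa k) hsupp)
      |>.eq_zero fun d hd h => h hd
  have hright : (toMatrix x - 1) * kappa c R k = 0 :=
    (Supported.mul (W := fun d => ¬ d.Sublist c)
      (fun y _ hy hk h => hy.2 ((hk.append_left y).trans h)) hsupp (supported_kappa k))
      |>.eq_zero fun d hd h => h hd
  refine toMatrix_injective ?_
  rw [map_mul, map_mul, toMatrix_meridian, add_mul, mul_add, one_mul, mul_one]
  rw [mul_sub, mul_one, sub_eq_zero] at hleft
  rw [sub_mul, one_mul, sub_eq_zero] at hright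
  rw [hleft, hright]

end unitriangular

namespace Nanophrase

open unitriangular

variable {n : ℕ} {p p' : Nanophrase.{u} AlphaV n} {c : List (Fin n)} {hc : c.Nodup} {i : Fin n}
  {R : Type*} [CommRing R] {m : p.Letter → unitriangular c R}

theorem phi_rho_eq_mu {q : ℕ} (hq : c.length + 2 ≤ q) {d : List (Fin n)} (hd : d.Sublist c)
    (k : Fin n) :
    NCSeries.phi (p.etaWord (p.rho q (p.signedWord k (p.word k)))) d = p.mu d k :=
  p.expansion_eq_mu d k q (by omega) (by have := hd.length_le; omega)

theorem IsColoring.toMatrix_longitude (hm : p.IsColoring (meridian hc R) m) (k : Fin n)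
    {a b : Fin (c.length + 1)} (hab : a ≤ b) :
    toMatrix (p.longitude m k) a b = p.mu (gapInterval c a b) k := by
  obtain ⟨d, hd⟩ := hm.eventually_eval_rho_eq (commutesWithConjugates_meridian hc)
  rw [← hd (max d (c.length + 2)) (le_max_left _ _), toMatrix_eval_meridian_apply hc _ hab,
    phi_rho_eq_mu (le_max_right _ _) (gapInterval_sublist c _ _)]

theorem IsColoring.toMatrix_longitude_zero_last (hm : p.IsColoring (meridian hc R) m)
    (k : Fin n) : toMatrix (p.longitude m k) 0 (Fin.last _) = p.mu c k := by
  rw [hm.toMatrix_longitude k (Fin.zero_le _), Fin.val_zero, Fin.val_last,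
    gapInterval_zero_length]

theorem mu_eq_of_transfersTo (h : TransfersTo (meridian hc ℤ) p p') (hi : i ∉ c) :
    p.mu c i = p'.mu c i := by
  obtain ⟨m, hm⟩ := p.exists_isColoring (commutesWithConjugates_meridian (R := ℤ) hc)
  obtain ⟨m', hm', hlong⟩ := h m hm
  have hbot : Subgroup.normalClosure ({meridian hc ℤ i} : Set (unitriangular c ℤ)) = ⊥ := by
    rw [meridian_eq_one hc hi, eq_bot_iff]
    exact Subgroup.normalClosure_le_normal (by simp)
  have heq : p'.longitude m' i = p.longitude m i := by
    have hmem := QuotientGroup.eq.1 (hlong i)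
    rwa [hbot, Subgroup.mem_bot, inv_mul_eq_one] at hmem
  have hmu := hm.toMatrix_longitude_zero_last i
  rw [← heq, hm'.toMatrix_longitude_zero_last i] at hmu
  exact_mod_cast hmu.symm

theorem muCongruent_of_transfersTo
    (h : ∀ (c : List (Fin n)) (hc : c.Nodup), TransfersTo (meridian hc ℤ) p p') :
    MuCongruent p p' := by
  intro c i hn N _
  have hi : i ∉ c := fun hic => List.disjoint_of_nodup_append hn hic (List.mem_singleton_self i)
  rw [mu_eq_of_transfersTo (h c hn.of_append_left) hi]

theorem mu_eq_zero (hzero : ∀ e ∈ lowerSequences (c ++ [i]), (p.muSeq e : R) = 0)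
    {d e : List (Fin n)} {k : Fin n} (hd : d ≠ []) (he : e.Sublist (c ++ [i]))
    (hlt : d.length < c.length) (hrot : (d ++ [k]).IsRotated e) : (p.mu d k : R) = 0 := by
  have hlen := hrot.perm.length_eq
  have hpos := List.length_pos_iff.2 hd
  rw [← muSeq_append]
  refine hzero _ (mem_lowerSequences.2 ⟨?_, e, he, ?_, hrot⟩)
  all_goals simp only [List.length_append, List.length_singleton] at hlen ⊢; omega

theorem IsColoring.commute_longitude (hm : p.IsColoring (meridian hc R) m)
    (hzero : ∀ e ∈ lowerSequences (c ++ [i]), (p.muSeq e : R) = 0) (k : Fin n) :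
    Commute (meridian hc R k) (p.longitude m k) := by
  have hmu : ∀ d : List (Fin n), d ≠ [] → ∀ e : List (Fin n), e.Sublist c →
      (d ++ [k]).IsRotated e → (p.mu d k : R) = 0 := by
    intro d hd e he hrot
    have hlen := hrot.perm.length_eq
    rw [List.length_append, List.length_singleton] at hlen
    have := he.length_le
    exact mu_eq_zero hzero hd (he.trans (List.sublist_append_left _ _)) (by omega) hrot
  refine commute_meridian hc fun a b hab hne => ?_
  obtain ⟨hle, hlen⟩ := degreeGE_toMatrix_sub_one (p.longitude m k) a b
    (by rwa [Matrix.sub_apply, Matrix.one_apply_ne hab, sub_zero])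
  rw [hm.toMatrix_longitude k hle] at hne
  have hnil := List.length_pos_iff.1 hlen
  exact ⟨fun h => hne (hmu _ hnil _ h List.isRotated_append),
    fun h => hne (hmu _ hnil _ h (.refl _))⟩

/-- The leading coefficient of a longitude does not depend on the choice of base points. -/
theorem IsColoring.longitude_conj {y : Fin n → unitriangular c R}
    (hm : p.IsColoring (fun j => (y j)⁻¹ * meridian hc R j * y j) m)
    (hzero : ∀ e ∈ lowerSequences (c ++ [i]), (p.muSeq e : R) = 0) :
    p.longitude m i ∈ Subgroup.center (unitriangular c R) ∧
      toMatrix (p.longitude m i) 0 (Fin.last _) = p.mu c i := by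
  obtain ⟨d, hd⟩ :=
    hm.eventually_eval_rho_eq fun j => (commutesWithConjugates_meridian hc j).conj (y j)
  set q := max d (c.length + 2)
  set w := p.etaWord (p.rho q (p.signedWord i (p.word i)))
  have hphi : ∀ e : List (Fin n), e.Sublist c → NCSeries.phi w e = p.mu e i :=
    fun e he => phi_rho_eq_mu (le_max_right _ _) he i
  have hw : ∀ e : List (Fin n), e.Sublist c → e ≠ [] → e ≠ c → (NCSeries.phi w e : R) = 0 := by
    intro e he hnil hne
    rw [hphi e he]
    exact mu_eq_zero hzero hnil (he.append_right _)
      (lt_of_le_of_ne he.length_le fun h => hne (he.eq_of_length h)) (.refl _)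
  have heval : p.longitude m i = SignedWord.eval (meridian hc R) w := by
    rw [← eval_conj_meridian hc hw, hd q (le_max_left _ _)]
  rw [heval]
  refine ⟨degreeSubgroup_length_le_center (eval_meridian_mem_degreeSubgroup hw), ?_⟩
  rw [toMatrix_eval_meridian_apply hc _ (Fin.zero_le _), Fin.val_zero, Fin.val_last,
    gapInterval_zero_length, hphi c (.refl _)]

end Nanophrase

/-! ### The shift move -/

namespace Nanophrase

open unitriangular

/-- The change of the base points of the components when the letter `A` is moved from the beginning
to the end of the component `k`. -/
def baseChange {n : ℕ} (p : Nanophrase.{u} AlphaV n) {G : Type*} [Group G] (m : p.Letter → G)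
    (k : Fin n) (A : p.Letter) : Fin n → G :=
  Pi.mulSingle k (p.val m k A)

section Shift

variable {n : ℕ} {p : Nanophrase.{u} AlphaV n} {proj' : p.Letter → AlphaV} {k j : Fin n}
  {A X : p.Letter} {x : List p.Letter} {w' : Fin n → List p.Letter} {G : Type*} [Group G]
  {g : Fin n → G} {m : p.Letter → G} (hk : p.word k = A :: x)
  (hk' : w' = Function.update p.word k (x ++ [A])) (hw' : IsGauss w')

include hk hk'

theorem mem_shift_iff : X ∈ w' j ↔ X ∈ p.word j := by
  subst hk'
  rcases eq_or_ne j k with rfl | hj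
  · simp [hk, or_comm]
  · rw [Function.update_of_ne hj]

variable (hproj : ∀ X, X ≠ A ∨ A ∉ x → proj' X = p.proj X)

include hproj

theorem sign_shift (hX : X ∈ w' j) :
    sign ⟨p.Letter, proj', w', hw'⟩ j X = p.sign j X := by
  by_cases h : X ≠ A ∨ A ∉ x
  · simp only [sign, mem_shift_iff hk hk', hproj X h]
  · push Not at h
    obtain ⟨rfl, hx⟩ := h
    have hcount : 2 ≤ (p.word k).count X := by
      rw [hk, List.count_cons_self]
      have := List.count_pos_iff.2 hx
      omega
    have honly : ∀ i, X ∈ p.word i → i = k := fun i => eq_of_two_le_count hcount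
    obtain rfl := honly j ((mem_shift_iff hk hk').1 hX)
    rw [sign_eq_zero honly]
    exact sign_eq_zero (p := ⟨p.Letter, proj', w', hw'⟩)
      fun i hi => honly i ((mem_shift_iff hk hk').1 hi)

theorem map_val_shift {l : List p.Letter} (hl : l ⊆ w' j) :
    l.map (val ⟨p.Letter, proj', w', hw'⟩ m j) = l.map (p.val m j) :=
  List.map_congr_left fun _ hX => by rw [val, val, sign_shift hk hk' hw' hproj (hl hX)]

theorem isOver_shift_iff :
    IsOver ⟨p.Letter, proj', w', hw'⟩ j X ↔ p.IsOver j X := by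
  unfold IsOver
  simp only [mem_shift_iff hk hk']
  refine and_congr_right fun hX => ?_
  rw [sign_shift hk hk' hw' hproj ((mem_shift_iff hk hk').2 hX)]

theorem longitude_shift (m : p.Letter → G) (j : Fin n) :
    longitude ⟨p.Letter, proj', w', hw'⟩ m j =
      (p.baseChange m k A j)⁻¹ * p.longitude m j * p.baseChange m k A j := by
  rw [longitude, map_val_shift hk hk' hw' hproj (List.Subset.refl _), hk']
  rcases eq_or_ne j k with rfl | hj
  · simp [longitude, baseChange, hk]
  · simp [longitude, baseChange, hj]

theorem isColoring_shift (hg : ∀ j, CommutesWithConjugates (g j)) (hm : p.IsColoring g m)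
    (hcomm : Commute (g k) (p.longitude m k)) :
    IsColoring ⟨p.Letter, proj', w', hw'⟩
      (fun j => (p.baseChange m k A j)⁻¹ * g j * p.baseChange m k A j) m := by
  rw [isColoring_iff hg] at hm
  rw [isColoring_iff fun j => (hg j).conj _]
  intro j (B : p.Letter) hB
  have hover := (isOver_shift_iff hk hk' hw' hproj).1 hB
  obtain ⟨u, v, huv⟩ : ∃ u v : List p.Letter, w' j = u ++ B :: v := List.append_of_mem hB.1
  have hu : u ⊆ w' j := huv ▸ List.subset_append_left _ _
  rw [hB.conjBefore_eq huv, map_val_shift hk hk' hw' hproj hu, hm j B hover]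
  rw [hk'] at huv
  rcases eq_or_ne j k with rfl | hjk
  · rw [Function.update_self] at huv
    rw [baseChange, Pi.mulSingle_eq_same]
    rcases List.eq_nil_or_concat' v with rfl | ⟨v, C, rfl⟩
    · obtain ⟨rfl, hAB⟩ := List.append_inj' huv rfl
      obtain rfl : A = B := by simpa using hAB
      have hone : p.val m j A = 1 := val_eq_one hover.2.1
      have hlong : p.longitude m j = (x.map (p.val m j)).prod := by
        rw [longitude, hk, List.map_cons, List.prod_cons, hone, one_mul]
      rw [hover.conjBefore_eq (x := []) hk, hone, ← hlong]
      simpa using hcomm.symm.inv_mul_cancel.symm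
    · rw [← List.cons_append, ← List.append_assoc] at huv
      obtain ⟨rfl, -⟩ := List.append_inj' huv rfl
      rw [hover.conjBefore_eq (x := A :: u) hk, List.map_cons, List.prod_cons]
      group
  · rw [Function.update_of_ne hjk] at huv
    rw [hover.conjBefore_eq huv, baseChange, Pi.mulSingle_eq_of_ne hjk, inv_one, one_mul, mul_one]

end Shift

variable {n : ℕ} {p : Nanophrase.{u} AlphaV n} {proj' : p.Letter → AlphaV} {k i : Fin n}
  {A : p.Letter} {x : List p.Letter} {w' : Fin n → List p.Letter}

theorem mu_eq_of_shift {c : List (Fin n)} (hc : c.Nodup) {R : Type*} [CommRing R]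
    (hk : p.word k = A :: x) (hk' : w' = Function.update p.word k (x ++ [A])) (hw' : IsGauss w')
    (hproj : ∀ X, X ≠ A ∨ A ∉ x → proj' X = p.proj X)
    (hzero : ∀ e ∈ lowerSequences (c ++ [i]), (p.muSeq e : R) = 0)
    (hzero' : ∀ e ∈ lowerSequences (c ++ [i]), (muSeq ⟨p.Letter, proj', w', hw'⟩ e : R) = 0) :
    (p.mu c i : R) = mu ⟨p.Letter, proj', w', hw'⟩ c i := by
  have hg := commutesWithConjugates_meridian hc (R := R)
  obtain ⟨m, hm⟩ := p.exists_isColoring hg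
  have hm' := isColoring_shift hk hk' hw' hproj hg hm (hm.commute_longitude hzero k)
  obtain ⟨hcenter, hmu'⟩ := hm'.longitude_conj hzero'
  have hlong := longitude_shift hk hk' hw' hproj m i
  have hconj : p.longitude m i = p.baseChange m k A i *
      longitude ⟨p.Letter, proj', w', hw'⟩ m i * (p.baseChange m k A i)⁻¹ := by
    rw [hlong]
    group
  rw [← hm.toMatrix_longitude_zero_last, ← hmu', hconj, Subgroup.mem_center_iff.1 hcenter,
    mul_inv_cancel_right]

theorem muCongruent_shift (hk : p.word k = A :: x)
    (hk' : w' = Function.update p.word k (x ++ [A])) (hw' : IsGauss w')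
    (hproj : ∀ X, X ≠ A ∨ A ∉ x → proj' X = p.proj X) :
    MuCongruent p ⟨p.Letter, proj', w', hw'⟩ :=
  muCongruent_of_cast_eq fun _ _ hn _ _ hzero =>
    mu_eq_of_shift hn.of_append_left hk hk' hw' hproj (fun e he => (hzero e he).1)
      fun e he => (hzero e he).2

end Nanophrase

theorem ExtMMove.muCongruent {n : ℕ} {p p' : Nanophrase.{u} AlphaV n}
    (h : ExtMMove weldedData p p') : Nanophrase.MuCongruent p p' := by
  open Nanophrase unitriangular in
  cases h with
  | iso _ _ f hproj hword =>
    exact muCongruent_of_transfersTo fun _ _ => transfersTo_iso f hproj hword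
  | h1 _ _ A f hproj x y hp hp' =>
    exact muCongruent_of_transfersTo fun _ _ => transfersTo_h1 A f hproj x y hp hp'
  | h2 _ _ A B hτ f hproj x y z hp hp' =>
    exact muCongruent_of_transfersTo fun _ _ => transfersTo_h2 A B hτ f hproj x y z hp hp'
  | h3 L proj w w' hw hw' A B C hS x y z t hp hp' =>
    exact muCongruent_of_transfersTo fun _ hc => transfersTo_h3 (p := ⟨L, proj, w, hw⟩)
      (commutesWithConjugates_meridian hc) hw' A B C hS x y z t hp hp'
  | selfCrossing L proj w hw k A x y z hk =>
    have hcount : 2 ≤ (w k).count A := by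
      simp only [hk, List.count_append, List.count_singleton_self]
      omega
    exact muCongruent_of_transfersTo fun _ _ => transfersTo_selfCrossing hw hcount _
  | shift L proj w w' hw hw' k A x hk hk' =>
    refine muCongruent_shift (p := ⟨L, proj, w, hw⟩) hk hk' hw' fun X hX => ?_
    split_ifs with h
    · exact Function.update_of_ne (hX.resolve_right fun h' => h' h) _ _
    · rfl

theorem theorem8p2 {n : ℕ} (p p' : Nanophrase.{u} AlphaV n) (h : ExtMHomotopic weldedData p p')
    (c : List (Fin n)) (i : Fin n) (hc : c ≠ []) (hdistinct : (c ++ [i]).Nodup) :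
    p.mubar c i = p'.mubar c i := by
  induction h with
  | rel p p' h => exact h.muCongruent.mubar_eq hdistinct
  | refl p => rfl
  | symm p p' _ ih => exact ih.symm
  | trans p p' p'' _ _ ih ih' => exact ih.trans ih'
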